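/- Fix a norm $\|\cdot\|$ on $\mathbb R^d$. Let $\mathbb F\subset\mathbb C\subset[0,\infty)^d$ be closed cones containing $\boldsymbol 0$, put $\mathbb O=\mathbb C\setminus\mathbb F$ (with the relative topology), $d(\boldsymbol x,\mathbb F)=\inf_{\boldsymbol y\in\mathbb F}\|\boldsymbol x-\boldsymbol y\|$ and $\partial\aleph_{\mathbb O}=\{\boldsymbol x\in\mathbb O: d(\boldsymbol x,\mathbb F)=1\}$. Let $\boldsymbol Z_1,\boldsymbol Z_2,\dots$ be i.i.d. random vectors in $\mathbb C$ whose common distribution has a regularly varying tail on $\mathbb O$: there are a nondecreasing function $b(t)\uparrow\infty$ and a non-zero Borel measure $\nu$ on $\mathbb O$, finite on $\{\boldsymbol x\in\mathbb O:d(\boldsymbol x,\mathbb F)\ge r\}$ for every $r>0$, such that $$t\,P[\boldsymbol Z_1/b(t)\in B]\to\nu(B)\qquad(t\to\infty)$$ for every Borel set $B\subset\mathbb O$ with $\inf_{\boldsymbol x\in B}d(\boldsymbol x,\mathbb F)>0$ and $\nu(\partial B)=0$ (boundary relative to $\mathbb O$). Let $$S_{\mathbb O}(\Lambda)=\frac{\nu\{\boldsymbol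 x\in\mathbb O:d(\boldsymbol x,\mathbb F)\ge1,\ \boldsymbol x/d(\boldsymbol x,\mathbb F)\in\Lambda\}}{\nu\{\boldsymbol x\in\mathbb O:d(\boldsymbol x,\mathbb F)\ge1\}},\qquad \Lambda\subset\partial\aleph_{\mathbb O}\text{ Borel}.$$ Write $d_i^{\mathbb F}=d(\boldsymbol Z_i,\mathbb F)$, let $d_{(1)}^{\mathbb F}\ge\dots\ge d_{(n)}^{\mathbb F}$ be the order statistics of $d_1^{\mathbb F},\dots,d_n^{\mathbb F}$, let $\epsilon_{\boldsymbol x}$ be the unit point mass at $\boldsymbol x$, and for $k=k(n)$ define $$\hat S_n(\cdot)=\frac{\sum_{i=1}^n \mathbf 1[d_i^{\mathbb F}>d_{(k+1)}^{\mathbb F}]\;\epsilon_{\boldsymbol Z_i/d_i^{\mathbb F}}(\cdot)}{\sum_{i=1}^n \mathbf 1[d_i^{\mathbb F}>d_{(k+1)}^{\mathbb F}]},\qquad \tilde S_n(\cdot)=\frac1k\sum_{i=1}^n \mathbf 1[d_i^{\mathbb F}>d_{(k+1)}^{\mathbb F}]\;\epsilon_{\boldsymbol Z_i/d_i^{\mathbb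 F}}(\cdot)$$ (the two agree when $k\ge1$ and exactly $k$ of the $d_i^{\mathbb F}$ exceed $d_{(k+1)}^{\mathbb F}$, in particular in the absence of ties). Suppose $k(n)\to\infty$ and $n/k(n)\to\infty$ as $n\to\infty$. Then $S_{\mathbb O}$ is a probability measure on $\partial\aleph_{\mathbb O}$, the denominator of $\hat S_n$ is non-zero with probability tending to $1$, and, as $n\to\infty$, $$\hat S_n\Rightarrow S_{\mathbb O}$$ as random elements of the space $P(\partial\aleph_{\mathbb O})$ of probability measures with the topology of weak convergence and its Borel $\sigma$-algebra, whatever fixed value in $P(\partial\aleph_{\mathbb O})$ is given to $\hat S_n$ where its denominator vanishes. Also $\tilde S_n\Rightarrow S_{\mathbb O}$ as random elements of the space of finite Borel measures on $\partial\aleph_{\mathbb O}$ with the topology of weak convergence and its Borel $\sigma$-algebra. (For the finitely many $n$ with $k(n)+1>n$, put $d_{(k+1)}^{\mathbb F}=0$.) -/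

import Mathlib

open MeasureTheory ProbabilityTheory Filter Topology
open scoped ENNReal NNReal

noncomputable section

/-- A closed cone of `ℝ^d` contained in `[0, ∞)^d` and containing the origin. -/
structure IsClosedCone {d : ℕ} (A : Set (Fin d → ℝ)) : Prop where
  isClosed : IsClosed A
  zero_mem : (0 : Fin d → ℝ) ∈ A
  nonneg : ∀ x ∈ A, ∀ j, 0 ≤ x j
  smul_mem : ∀ x ∈ A, ∀ t : ℝ, 0 < t → t • x ∈ A

/-- The distance `d(x, F) = inf_{y ∈ F} ‖x - y‖`, where `‖·‖ = p` is the chosen norm on `ℝ^d`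
(used only for a norm `p` and a nonempty set `F`). -/
def normDist {d : ℕ} (p : Seminorm ℝ (Fin d → ℝ)) (F : Set (Fin d → ℝ)) (x : Fin d → ℝ) : ℝ :=
  ⨅ y : F, p (x - (y : Fin d → ℝ))

/-- The open cone `𝕆 = C \ F`; as a type it carries the relative topology and the trace of the
Borel `σ`-algebra. -/
abbrev openCone {d : ℕ} (C F : Set (Fin d → ℝ)) : Set (Fin d → ℝ) := C \ F

/-- The unit sphere `{x ∈ C \ F : d(x, F) = 1}` of the open cone `C \ F`. -/
abbrev coneSphere {d : ℕ} (p : Seminorm ℝ (Fin d → ℝ)) (C F : Set (Fin d → ℝ)) :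
    Set (Fin d → ℝ) :=
  {x | x ∈ openCone C F ∧ normDist p F x = 1}

/-- A set `B ⊆ 𝕆` is bounded away from `F`: it lies in `{x ∈ 𝕆 : d(x, F) ≥ r}` for some `r > 0`. -/
def BoundedAway {d : ℕ} (p : Seminorm ℝ (Fin d → ℝ)) (C F : Set (Fin d → ℝ))
    (B : Set (openCone C F)) : Prop :=
  ∃ r : ℝ, 0 < r ∧ ∀ x ∈ B, r ≤ normDist p F (x : Fin d → ℝ)

/-- Membership of a Borel measure on `𝕆` in the class `𝕄*(C, 𝕆)`: finite on `{d(·, F) ≥ r}` for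
every `r > 0`. -/
def InMStar {d : ℕ} (p : Seminorm ℝ (Fin d → ℝ)) (C F : Set (Fin d → ℝ))
    (ν : Measure (openCone C F)) : Prop :=
  ∀ r : ℝ, 0 < r → ν {x | r ≤ normDist p F (x : Fin d → ℝ)} < ∞

/-- Convergence in `𝕄*(C, 𝕆)`: convergence on Borel sets that are bounded away from `F` and whose
(relative) boundary is a null set of the limit. -/
def TendstoMStar {d : ℕ} {ι : Type*} (p : Seminorm ℝ (Fin d → ℝ)) (C F : Set (Fin d → ℝ))
    (m : ι → Measure (openCone C F)) (l : Filter ι) (ν : Measure (openCone C F)) : Prop :=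
  ∀ B : Set (openCone C F), MeasurableSet B → BoundedAway p C F B → ν (frontier B) = 0 →
    Tendsto (fun i => m i B) l (𝓝 (ν B))

/-- The measure `t · P[Z / b ∈ ·]` on `𝕆`. -/
def scaledTailLaw {d : ℕ} {Ω : Type*} [MeasurableSpace Ω] (P : Measure Ω) (C F : Set (Fin d → ℝ))
    (Z : Ω → Fin d → ℝ) (t b : ℝ) : Measure (openCone C F) :=
  ENNReal.ofReal t • (P.map (fun ω => b⁻¹ • Z ω)).comap Subtype.val

/-- The random vector `Z` has a distribution with a regularly varying tail on `𝕆 = C \ F`, with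
scaling function `b` and limit measure `ν`. -/
structure IsRegularlyVarying {d : ℕ} {Ω : Type*} [MeasurableSpace Ω] (P : Measure Ω)
    (p : Seminorm ℝ (Fin d → ℝ)) (C F : Set (Fin d → ℝ)) (Z : Ω → Fin d → ℝ) (b : ℝ → ℝ)
    (ν : Measure (openCone C F)) : Prop where
  monotone_scaling : MonotoneOn b (Set.Ioi 0)
  tendsto_scaling : Tendsto b atTop atTop
  inMStar : InMStar p C F ν
  ne_zero : ν ≠ 0
  tendsto_tail : TendstoMStar p C F (fun t : ℝ => scaledTailLaw P C F Z t (b t)) atTop ν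

/-- The spectral measure of a limit measure `ν`:
`S(Λ) = ν {x : d(x, F) ≥ 1, x / d(x, F) ∈ Λ} / ν {x : d(x, F) ≥ 1}` for Borel sets `Λ` of the
unit sphere. -/
def spectralMeasure {d : ℕ} (p : Seminorm ℝ (Fin d → ℝ)) (C F : Set (Fin d → ℝ))
    (ν : Measure (openCone C F)) : Measure (coneSphere p C F) :=
  (ν {x | 1 ≤ normDist p F (x : Fin d → ℝ)})⁻¹ •
    ((ν.restrict {x | 1 ≤ normDist p F (x : Fin d → ℝ)}).map
      (fun x : openCone C F =>
        (normDist p F (x : Fin d → ℝ))⁻¹ • (x : Fin d → ℝ))).comap Subtype.val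

/-- The `(k+1)`-st largest of the numbers `a 0, …, a (n-1)` (with value `0` unless `k + 1 ≤ n`).
`Tuple.sort a` puts `a` in increasing order and `Fin.rev` reads it from the top. -/
def descOrderStat {n : ℕ} (a : Fin n → ℝ) (k : ℕ) : ℝ :=
  if h : k < n then a (Tuple.sort a (Fin.rev ⟨k, h⟩)) else 0

/-- The `(k+1)`-st largest of the distances `d(z i, F)`, `i < n`. -/
def distOrderStat {d : ℕ} (p : Seminorm ℝ (Fin d → ℝ)) (F : Set (Fin d → ℝ)) (n k : ℕ)
    (z : ℕ → Fin d → ℝ) : ℝ :=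
  descOrderStat (fun i : Fin n => normDist p F (z i)) k

/-- The indices `i < n` with `d(z i, F) > u`. -/
def exceedances {d : ℕ} (p : Seminorm ℝ (Fin d → ℝ)) (F : Set (Fin d → ℝ)) (n : ℕ) (u : ℝ)
    (z : ℕ → Fin d → ℝ) : Finset ℕ :=
  (Finset.range n).filter (fun i => u < normDist p F (z i))

/-- The point measure `∑_{i < n, d(z i, F) > u} ε_{z i / d(z i, F)}` on the unit sphere. -/
def angularMeasure {d : ℕ} (p : Seminorm ℝ (Fin d → ℝ)) (C F : Set (Fin d → ℝ)) (n : ℕ) (u : ℝ)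
    (z : ℕ → Fin d → ℝ) : Measure (coneSphere p C F) :=
  ∑ i ∈ exceedances p F n u z,
    (Measure.dirac ((normDist p F (z i))⁻¹ • z i)).comap Subtype.val

instance {d : ℕ} (p : Seminorm ℝ (Fin d → ℝ)) (C F : Set (Fin d → ℝ)) (n : ℕ) (u : ℝ)
    (z : ℕ → Fin d → ℝ) : IsFiniteMeasure (angularMeasure p C F n u z) := by
  unfold angularMeasure
  infer_instance

/-- The point measure divided by the number of exceedances: the quotient that defines the
estimator with threshold `u` (with `u` the order statistic, the feasible estimator). -/
def angularQuotient {d : ℕ} (p : Seminorm ℝ (Fin d → ℝ)) (C F : Set (Fin d → ℝ)) (n : ℕ) (u : ℝ)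
    (z : ℕ → Fin d → ℝ) : Measure (coneSphere p C F) :=
  ((exceedances p F n u z).card : ℝ≥0∞)⁻¹ • angularMeasure p C F n u z

open Classical in
/-- The estimator `Ŝ_n` as an element of the space of probability measures on the unit sphere.
If nothing exceeds the order statistic, the defining quotient is `0 / 0`, and the arbitrary
value `S₀` is taken. -/
def spectralEstimator {d : ℕ} (p : Seminorm ℝ (Fin d → ℝ)) (C F : Set (Fin d → ℝ))
    (S₀ : ProbabilityMeasure (coneSphere p C F)) (n k : ℕ) (z : ℕ → Fin d → ℝ) :
    ProbabilityMeasure (coneSphere p C F) :=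
  if h : IsProbabilityMeasure (angularQuotient p C F n (distOrderStat p F n k z) z) then
    ⟨angularQuotient p C F n (distOrderStat p F n k z) z, h⟩
  else S₀

/-- The version `k⁻¹ ∑_{i < n, d(z i, F) > d_{(k+1)}} ε_{z i / d(z i, F)}` of the estimator, as an
element of the space of finite measures on the unit sphere. -/
def spectralEstimatorK {d : ℕ} (p : Seminorm ℝ (Fin d → ℝ)) (C F : Set (Fin d → ℝ))
    (n k : ℕ) (z : ℕ → Fin d → ℝ) : FiniteMeasure (coneSphere p C F) :=
  let M : FiniteMeasure (coneSphere p C F) :=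
    ⟨angularMeasure p C F n (distOrderStat p F n k z) z, inferInstance⟩
  (k : ℝ≥0)⁻¹ • M

/-- Weak convergence (convergence in distribution) of the random elements `X n` of a topological
space `E`, equipped with its Borel `σ`-algebra, to the nonrandom element `x`. Measurability of
every `X n` is part of the notion. -/
def WeaklyConvergesTo {Ω E : Type*} [MeasurableSpace Ω] [TopologicalSpace E] (P : Measure Ω)
    [IsProbabilityMeasure P] (X : ℕ → Ω → E) (x : E) : Prop :=
  letI : MeasurableSpace E := borel E
  haveI : BorelSpace E := ⟨rfl⟩
  TendstoInDistribution X atTop (fun _ : Ω => x) (fun _ => P) P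

end

/-!
Why the estimators are consistent.

Regular variation is used through tail integrals of functions of the direction: for a bounded
continuous `f ≥ 0` on the unit sphere, let `Φ x` be the expectation of `f (Z / d(Z, F))` over the
event `d(Z, F) > x`, and let `g u` be the integral of `f (x / d(x, F))` over `d(x, F) > u` against
the limit measure. The layer cake formula turns convergence on continuity sets into
`t Φ (u b(t)) → g u` (`tendsto_tail_lintegral`). Put `H = g` for `f = 1`.

The limits are all homogeneous with the same scales: if `l` is a cluster point of `b(s t) / b(t)`,
then `s g(l u) = g u` for every `f` at once (`RegularScaling.exists_scale`). The scales `l` have `1`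
as an accumulation point, so `H` is continuous and strictly decreasing, with limits `∞` at `0` and
`0` at `∞`, and every `g` is a multiple of `H` (`RegularScaling.mul_eq_mul`). The explicit power law
is not needed. The constant `g 1 / H 1` is the integral of `f` against the spectral measure
(`lintegral_spectralMeasure`).

For a deterministic threshold `u b(n/k)`, the sum of `f` over the exceedances, divided by `k`, has
mean converging to `g u` and variance of order `1 / k`, so it converges to `g u` in probability
(`tendsto_exceedanceSum`). With `f = 1` this shows that the order statistic divided by `b(n/k)`
tends to the level `c` with `H c = 1`. As sums over exceedances are monotone in the threshold, the
sums at the order statistic converge to `g c = g 1 / H 1`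
(`tendsto_exceedanceSum_distOrderStat`).

Convergence in probability is expressed by a filter on `ℕ × Ω` (`inProbability`). The weak topology
is characterized by convergence of integrals along arbitrary filters, so convergence of all
integrals in probability is convergence of the random measures in probability, which implies
weak convergence to the constant (`weaklyConvergesTo_of_tendsto`).
-/

open scoped BoundedContinuousFunction

/-! ### The distance to a closed cone -/

section NormDist

variable {d : ℕ} {p : Seminorm ℝ (Fin d → ℝ)} {C F : Set (Fin d → ℝ)}

lemma continuous_seminorm (p : Seminorm ℝ (Fin d → ℝ)) : Continuous p := by
  have h := p.convexOn.continuousOn isOpen_univ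
  exact continuousOn_univ.1 h

lemma normDist_nonneg (p : Seminorm ℝ (Fin d → ℝ)) (F : Set (Fin d → ℝ)) (x : Fin d → ℝ) :
    0 ≤ normDist p F x :=
  Real.iInf_nonneg fun _ => apply_nonneg p _

lemma normDist_le {y : Fin d → ℝ} (hy : y ∈ F) (x : Fin d → ℝ) : normDist p F x ≤ p (x - y) :=
  ciInf_le (f := fun y : F => p (x - (y : Fin d → ℝ)))
    ⟨0, by rintro _ ⟨z, rfl⟩; exact apply_nonneg p _⟩ ⟨y, hy⟩

lemma exists_lt_of_normDist_lt (hF : IsClosedCone F) {x : Fin d → ℝ} {r : ℝ}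
    (h : normDist p F x < r) : ∃ y ∈ F, p (x - y) < r := by
  have : Nonempty F := ⟨⟨0, hF.zero_mem⟩⟩
  obtain ⟨y, hy⟩ := exists_lt_of_ciInf_lt h
  exact ⟨y, y.2, hy⟩

lemma normDist_le_add (hF : IsClosedCone F) (x y : Fin d → ℝ) :
    normDist p F x ≤ normDist p F y + p (x - y) := by
  refine le_of_forall_pos_lt_add fun ε hε => ?_
  obtain ⟨z, hz, h⟩ := exists_lt_of_normDist_lt (p := p) hF
    (lt_add_of_pos_right (normDist p F y) hε)
  have h1 := normDist_le (p := p) hz x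
  have h2 : p (x - z) ≤ p (x - y) + p (y - z) := by
    simpa using map_add_le_add p (x - y) (y - z)
  linarith

lemma continuous_normDist (p : Seminorm ℝ (Fin d → ℝ)) (hF : IsClosedCone F) :
    Continuous (normDist p F) := by
  rw [continuous_iff_continuousAt]
  intro x
  have hc : Tendsto (fun y => p (y - x)) (𝓝 x) (𝓝 0) := by
    have : Continuous fun y => p (y - x) := (continuous_seminorm p).comp (continuous_sub_right x)
    simpa using this.tendsto x
  have h1 : Tendsto (fun y => normDist p F x - p (y - x)) (𝓝 x) (𝓝 (normDist p F x)) := by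
    simpa using tendsto_const_nhds.sub hc
  have h2 : Tendsto (fun y => normDist p F x + p (y - x)) (𝓝 x) (𝓝 (normDist p F x)) := by
    simpa using tendsto_const_nhds.add hc
  refine tendsto_of_tendsto_of_tendsto_of_le_of_le h1 h2 (fun y => ?_) fun y => ?_
  · have := normDist_le_add (p := p) hF x y
    rw [← map_sub_rev p y x] at this
    simp only
    linarith
  · exact normDist_le_add hF y x

lemma normDist_smul (hF : IsClosedCone F) {t : ℝ} (ht : 0 < t) (x : Fin d → ℝ) :
    normDist p F (t • x) = t * normDist p F x := by
  have key : ∀ {s : ℝ}, 0 < s → ∀ z, normDist p F (s • z) ≤ s * normDist p F z := by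
    intro s hs z
    refine le_of_forall_pos_lt_add fun ε hε => ?_
    obtain ⟨y, hy, h⟩ := exists_lt_of_normDist_lt (p := p) hF
      (lt_add_of_pos_right (normDist p F z) (div_pos hε hs))
    have h1 := normDist_le (p := p) (hF.smul_mem y hy s hs) (s • z)
    rw [← smul_sub, map_smul_eq_mul, Real.norm_of_nonneg hs.le] at h1
    have h2 := mul_lt_mul_of_pos_left h hs
    rw [mul_add, mul_div_cancel₀ _ hs.ne'] at h2
    linarith
  refine le_antisymm (key ht x) ?_
  have h := key (inv_pos.2 ht) (t • x)
  rw [smul_smul, inv_mul_cancel₀ ht.ne', one_smul] at h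
  have := mul_le_mul_of_nonneg_left h ht.le
  rwa [mul_inv_cancel_left₀ ht.ne'] at this

lemma normDist_eq_zero_of_mem {x : Fin d → ℝ} (hx : x ∈ F) : normDist p F x = 0 :=
  le_antisymm (by simpa using normDist_le (p := p) hx x) (normDist_nonneg p F x)

/-- A norm on `ℝ^d` dominates a multiple of the sup norm, by compactness of the unit sphere. -/
lemma exists_norm_le_seminorm (hp : ∀ x, p x = 0 → x = 0) : ∃ c > 0, ∀ x, c * ‖x‖ ≤ p x := by
  rcases (Metric.sphere (0 : Fin d → ℝ) 1).eq_empty_or_nonempty with h | h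
  · refine ⟨1, one_pos, fun x => ?_⟩
    by_cases hx : x = 0
    · simp [hx]
    · exfalso
      have : ‖x‖⁻¹ • x ∈ Metric.sphere (0 : Fin d → ℝ) 1 := by
        simp [norm_smul, inv_mul_cancel₀ (norm_ne_zero_iff.2 hx)]
      simp [h] at this
  · obtain ⟨z, hz, hmin⟩ := (isCompact_sphere (0 : Fin d → ℝ) 1).exists_isMinOn h
      (continuous_seminorm p).continuousOn
    have hz0 : z ≠ 0 := by
      rintro rfl
      simp at hz
    refine ⟨p z, lt_of_le_of_ne (apply_nonneg p z) fun h0 => hz0 (hp z h0.symm), fun x => ?_⟩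
    by_cases hx : x = 0
    · simp [hx]
    · have hn : 0 < ‖x‖ := norm_pos_iff.2 hx
      have hm : ‖x‖⁻¹ • x ∈ Metric.sphere (0 : Fin d → ℝ) 1 := by
        simp [norm_smul, inv_mul_cancel₀ hn.ne']
      have := hmin hm
      simp only [Set.mem_ofPred_eq, map_smul_eq_mul, norm_inv, norm_norm] at this
      rwa [inv_mul_eq_div, le_div_iff₀ hn] at this

lemma normDist_pos (hp : ∀ x, p x = 0 → x = 0) (hF : IsClosedCone F) {x : Fin d → ℝ}
    (hx : x ∉ F) : 0 < normDist p F x := by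
  obtain ⟨c, hc, hcx⟩ := exists_norm_le_seminorm hp
  obtain ⟨r, hr, hball⟩ := Metric.isOpen_iff.1 hF.isClosed.isOpen_compl x hx
  by_contra! h
  obtain ⟨y, hy, hlt⟩ := exists_lt_of_normDist_lt (p := p) hF (h.trans_lt (mul_pos hc hr))
  have h1 := (hcx (x - y)).trans_lt hlt
  have h2 : ‖x - y‖ < r := lt_of_mul_lt_mul_left h1 hc.le
  exact hball (by rwa [mem_ball_iff_norm, norm_sub_rev]) hy

lemma mem_openCone_of_normDist_pos {x : Fin d → ℝ} (hx : x ∈ C) (h : 0 < normDist p F x) :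
    x ∈ openCone C F :=
  ⟨hx, fun hxF => h.ne' (normDist_eq_zero_of_mem hxF)⟩

lemma inv_normDist_smul_mem (hC : IsClosedCone C) (hF : IsClosedCone F) {x : Fin d → ℝ}
    (hx : x ∈ C) (h : 0 < normDist p F x) : (normDist p F x)⁻¹ • x ∈ coneSphere p C F := by
  have h1 : normDist p F ((normDist p F x)⁻¹ • x) = 1 := by
    rw [normDist_smul hF (inv_pos.2 h), inv_mul_cancel₀ h.ne']
  exact ⟨mem_openCone_of_normDist_pos (p := p) (hC.smul_mem x hx _ (inv_pos.2 h))
    (h1 ▸ one_pos), h1⟩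

lemma measurableSet_coneSphere (hC : IsClosedCone C) (hF : IsClosedCone F) :
    MeasurableSet (coneSphere p C F) :=
  (hC.isClosed.measurableSet.diff hF.isClosed.measurableSet).inter
    ((continuous_normDist p hF).measurable (measurableSet_singleton 1))

end NormDist

/-! ### Regular variation of tail functions -/

/-- The function `g` is the limit of the rescaled tail function `Φ`: `t Φ(u b(t)) → g(u)` for `u` in
the set `A` of admissible arguments. -/
structure TailLimit (b : ℝ → ℝ) (A : Set ℝ) (Φ g : ℝ → ℝ) : Prop where
  antitone_tail : Antitone Φ
  antitoneOn_limit : AntitoneOn g (Set.Ioi 0)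
  right_continuous : ∀ u, 0 < u → ContinuousWithinAt g (Set.Ici u) u
  tendsto : ∀ u ∈ A, Tendsto (fun t => t * Φ (u * b t)) atTop (𝓝 (g u))

/-- The hypotheses under which the scaling function `b` is regularly varying: the tail function
`Φ` rescaled by `b` has the nontrivial limit `H`, which vanishes at infinity. -/
structure RegularScaling (b : ℝ → ℝ) (A : Set ℝ) (Φ H : ℝ → ℝ) : Prop extends
    TailLimit b A Φ H where
  monotone_scaling : MonotoneOn b (Set.Ioi 0)
  tendsto_scaling : Tendsto b atTop atTop
  dense : ∀ u v, 0 < u → u < v → ∃ w ∈ A, u < w ∧ w < v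
  tendsto_zero : Tendsto H atTop (𝓝 0)
  exists_pos : ∃ u, 0 < u ∧ 0 < H u

section RegularVariation

variable {b : ℝ → ℝ} {A : Set ℝ} {Φ g Ψ H : ℝ → ℝ}

lemma TailLimit.exists_gt (h : TailLimit b A Φ g) {u ε : ℝ} (hu : 0 < u) (hε : 0 < ε) :
    ∃ v, u < v ∧ g u - ε < g v := by
  have h1 : ∀ᶠ v in 𝓝[>] u, g u - ε < g v :=
    ((h.right_continuous u hu).mono Set.Ioi_subset_Ici_self).eventually
      (lt_mem_nhds (sub_lt_self _ hε))
  obtain ⟨v, hv, huv⟩ := (h1.and self_mem_nhdsWithin).exists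
  exact ⟨v, huv, hv⟩

/-- If `b (s t) / b t` were unbounded, then a fixed level at time `s t` would correspond to
arbitrarily high levels at time `t`, where the limit `H` is arbitrarily small. -/
lemma RegularScaling.exists_ratio_le (h : RegularScaling b A Ψ H) {s : ℝ} (hs : 1 < s) :
    ∃ M, ∀ᶠ t in atTop, b (s * t) / b t ≤ M := by
  have hs0 : 0 < s := one_pos.trans hs
  obtain ⟨u, hu, hHu⟩ := h.exists_pos
  obtain ⟨v, huv, hv⟩ := h.exists_gt hu hHu
  obtain ⟨w, hwA, huw, hwv⟩ := h.dense u v hu huv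
  have hw : 0 < w := hu.trans huw
  have hHw : 0 < H w := by
    have := h.antitoneOn_limit (Set.mem_Ioi.2 hw) (Set.mem_Ioi.2 (hu.trans huv)) hwv.le
    linarith
  obtain ⟨m, hm, hm1⟩ := ((h.tendsto_zero.eventually
    (gt_mem_nhds (div_pos hHw (mul_pos two_pos hs0)))).and (eventually_ge_atTop (1 : ℝ))).exists
  obtain ⟨q, hqA, hmq, -⟩ := h.dense m (m + 1) (one_pos.trans_le hm1) (by linarith)
  have hq : 0 < q := by linarith
  have hHq : H q < H w / (2 * s) :=
    (h.antitoneOn_limit (Set.mem_Ioi.2 (one_pos.trans_le hm1)) (Set.mem_Ioi.2 hq)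
      hmq.le).trans_lt hm
  have e1 := (h.tendsto q hqA).eventually (gt_mem_nhds hHq)
  have e2 := ((h.tendsto w hwA).comp (tendsto_id.const_mul_atTop hs0)).eventually
    (lt_mem_nhds (half_lt_self hHw))
  refine ⟨q / w, ?_⟩
  filter_upwards [e1, e2, h.tendsto_scaling.eventually (eventually_gt_atTop 0),
    eventually_gt_atTop 0] with t h1 h2 hb ht
  by_contra! hlt
  rw [div_lt_div_iff₀ hw hb] at hlt
  have h3 := h.antitone_tail (show q * b t ≤ w * b (s * t) by linarith)
  simp only [Function.comp_apply, id_eq] at h2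
  have h4 : t * Ψ (w * b (s * t)) ≤ t * Ψ (q * b t) := mul_le_mul_of_nonneg_left h3 ht.le
  have h5 : H w / 2 < s * (H w / (2 * s)) := by
    have : s * (t * Ψ (w * b (s * t))) < s * (H w / (2 * s)) :=
      mul_lt_mul_of_pos_left (h4.trans_lt h1) hs0
    linarith
  have h6 : s * (H w / (2 * s)) = H w / 2 := by field_simp
  linarith

/-- A time change by the factor `s` amounts to a change of level by a factor `l`, a cluster point
of `b (s t) / b t`. It depends on the scaling function only and thus is the same for all tail
functions. -/
lemma RegularScaling.exists_scale (h : RegularScaling b A Ψ H) {s : ℝ} (hs : 1 < s) :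
    ∃ l, 1 < l ∧ ∀ Φ g, TailLimit b A Φ g → ∀ u, 0 < u → s * g (l * u) = g u := by
  have hs0 : 0 < s := one_pos.trans hs
  obtain ⟨M, hM⟩ := h.exists_ratio_le hs
  have hbpos := h.tendsto_scaling.eventually (eventually_gt_atTop 0)
  have hIcc : ∀ᶠ t in atTop, b (s * t) / b t ∈ Set.Icc 1 M := by
    filter_upwards [hM, hbpos, eventually_gt_atTop 0] with t h1 hb ht
    refine ⟨?_, h1⟩
    rw [one_le_div hb]
    exact h.monotone_scaling (Set.mem_Ioi.2 ht) (Set.mem_Ioi.2 (mul_pos hs0 ht))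
      (le_mul_of_one_le_left ht.le hs.le)
  obtain ⟨l, hl, hcl⟩ := isCompact_Icc.exists_mapClusterPt (tendsto_principal.2 hIcc)
  have hl0 : 0 < l := one_pos.trans_le hl.1
  have key : ∀ Φ g, TailLimit b A Φ g → ∀ u, 0 < u → s * g (l * u) = g u := by
    intro Φ g hg u hu
    -- The two comparisons need `b (s t) / b t` to be close to `l` only for arbitrarily large `t`:
    -- both sides converge along the full filter.
    have up : ∀ w ∈ A, ∀ v ∈ A, 0 < w → v < l * w → g w ≤ s * g v := by
      intro w hw v hv hw0 hvw
      have hf : ∃ᶠ t in atTop, v / w < b (s * t) / b t :=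
        hcl.frequently (lt_mem_nhds ((div_lt_iff₀ hw0).2 hvw))
      have e1 := (hg.tendsto w hw).comp (tendsto_id.const_mul_atTop hs0)
      have e2 := (hg.tendsto v hv).const_mul s
      refine le_of_tendsto_of_tendsto_of_frequently e1 e2 ?_
      refine (hf.and_eventually (hbpos.and (eventually_gt_atTop 0))).mono ?_
      rintro t ⟨h1, hb, ht⟩
      rw [div_lt_div_iff₀ hw0 hb] at h1
      have h3 := hg.antitone_tail (show v * b t ≤ w * b (s * t) by linarith)
      simp only [Function.comp_apply, id_eq]
      rw [mul_assoc]
      gcongr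
    have down : ∀ w ∈ A, ∀ v ∈ A, 0 < w → l * w < v → s * g v ≤ g w := by
      intro w hw v hv hw0 hvw
      have hf : ∃ᶠ t in atTop, b (s * t) / b t < v / w :=
        hcl.frequently (gt_mem_nhds ((lt_div_iff₀ hw0).2 hvw))
      have e1 := (hg.tendsto w hw).comp (tendsto_id.const_mul_atTop hs0)
      have e2 := (hg.tendsto v hv).const_mul s
      refine le_of_tendsto_of_tendsto_of_frequently e2 e1 ?_
      refine (hf.and_eventually (hbpos.and (eventually_gt_atTop 0))).mono ?_
      rintro t ⟨h1, hb, ht⟩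
      rw [div_lt_div_iff₀ hb hw0] at h1
      have h3 := hg.antitone_tail (show w * b (s * t) ≤ v * b t by linarith)
      simp only [Function.comp_apply, id_eq]
      rw [mul_assoc]
      gcongr
    have hlu : 0 < l * u := mul_pos hl0 hu
    refine le_antisymm ?_ ?_
    · refine le_of_forall_pos_lt_add fun ε hε => ?_
      obtain ⟨v0, hv0, hgv⟩ := hg.exists_gt hlu (div_pos hε hs0)
      obtain ⟨w, hwA, huw, hwv⟩ := h.dense u (v0 / l) hu ((lt_div_iff₀' hl0).2 hv0)
      rw [lt_div_iff₀' hl0] at hwv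
      have hw : 0 < w := hu.trans huw
      obtain ⟨v, hvA, hwv', hvv⟩ := h.dense (l * w) v0 (mul_pos hl0 hw) hwv
      have h1 := down w hwA v hvA hw hwv'
      have hv : 0 < v := (mul_pos hl0 hw).trans hwv'
      have h2 := hg.antitoneOn_limit (Set.mem_Ioi.2 hv) (Set.mem_Ioi.2 (hlu.trans hv0)) hvv.le
      have h3 := hg.antitoneOn_limit (Set.mem_Ioi.2 hu) (Set.mem_Ioi.2 hw) huw.le
      have h4 : s * (g (l * u) - ε / s) < s * g v :=
        mul_lt_mul_of_pos_left (hgv.trans_le h2) hs0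
      rw [mul_sub, mul_div_cancel₀ _ hs0.ne'] at h4
      linarith
    · refine le_of_forall_pos_lt_add fun ε hε => ?_
      obtain ⟨w0, hw0, hgw⟩ := hg.exists_gt hu hε
      obtain ⟨w, hwA, huw, hww⟩ := h.dense u w0 hu hw0
      have hw : 0 < w := hu.trans huw
      obtain ⟨v, hvA, huv, hvw⟩ := h.dense (l * u) (l * w) hlu (mul_lt_mul_of_pos_left huw hl0)
      have h1 := up w hwA v hvA hw hvw
      have h2 := hg.antitoneOn_limit (Set.mem_Ioi.2 hlu) (Set.mem_Ioi.2 (hlu.trans huv)) huv.le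
      have h3 := hg.antitoneOn_limit (Set.mem_Ioi.2 hw) (Set.mem_Ioi.2 (hu.trans hw0)) hww.le
      have h4 := mul_le_mul_of_nonneg_left h2 hs0.le
      linarith
  refine ⟨l, lt_of_le_of_ne hl.1 ?_, key⟩
  rintro rfl
  obtain ⟨u, hu, hHu⟩ := h.exists_pos
  have := key Ψ H h.toTailLimit u hu
  rw [one_mul] at this
  nlinarith

lemma scale_pow {s l : ℝ} (hl : 0 < l) (h : ∀ u, 0 < u → s * g (l * u) = g u) {u : ℝ}
    (hu : 0 < u) (n : ℕ) : s ^ n * g (l ^ n * u) = g u := by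
  induction n with
  | zero => simp
  | succ n ih =>
    rw [← ih, ← h (l ^ n * u) (by positivity), pow_succ, pow_succ, mul_assoc, ← mul_assoc l,
      mul_comm l]

lemma RegularScaling.pos (h : RegularScaling b A Ψ H) {u : ℝ} (hu : 0 < u) : 0 < H u := by
  obtain ⟨l, hl, hscale⟩ := h.exists_scale one_lt_two
  have hl0 : 0 < l := one_pos.trans hl
  obtain ⟨u0, hu0, hH⟩ := h.exists_pos
  obtain ⟨n, hn⟩ := pow_unbounded_of_one_lt (u / u0) hl
  rw [div_lt_iff₀ hu0] at hn
  have h1 := scale_pow hl0 (hscale Ψ H h.toTailLimit) hu0 n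
  have h2 : 0 < H (l ^ n * u0) := by
    by_contra! hle
    have : (2 : ℝ) ^ n * H (l ^ n * u0) ≤ 0 := mul_nonpos_of_nonneg_of_nonpos (by positivity) hle
    linarith
  exact h2.trans_le (h.antitoneOn_limit (Set.mem_Ioi.2 hu) (Set.mem_Ioi.2 (hu.trans hn)) hn.le)

lemma RegularScaling.exists_large (h : RegularScaling b A Ψ H) (K : ℝ) :
    ∃ u, 0 < u ∧ K < H u := by
  obtain ⟨l, hl, hscale⟩ := h.exists_scale one_lt_two
  have hl0 : 0 < l := one_pos.trans hl
  obtain ⟨n, hn⟩ := pow_unbounded_of_one_lt (K / H 1) one_lt_two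
  rw [div_lt_iff₀ (h.pos one_pos)] at hn
  have h1 := scale_pow hl0 (hscale Ψ H h.toTailLimit) (u := (l ^ n)⁻¹) (by positivity) n
  rw [mul_inv_cancel₀ (by positivity)] at h1
  exact ⟨(l ^ n)⁻¹, by positivity, by linarith⟩

/-- The scales `l` of `exists_scale` accumulate at `1`. -/
lemma RegularScaling.exists_small_scale (h : RegularScaling b A Ψ H) {s₀ l₀ : ℝ} (hs₀ : 1 < s₀)
    (hl₀ : 1 < l₀) : ∃ s l, 1 < s ∧ s < s₀ ∧ 1 < l ∧ l < l₀ ∧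
      ∀ Φ g, TailLimit b A Φ g → ∀ u, 0 < u → s * g (l * u) = g u := by
  have hH1 := h.pos one_pos
  obtain ⟨M, hM, hM1⟩ := ((h.tendsto_zero.eventually
    (gt_mem_nhds (half_pos hH1))).and (eventually_ge_atTop (1 : ℝ))).exists
  have e1 := (tendsto_pow_atTop_atTop_of_one_lt hs₀).eventually (eventually_gt_atTop 2)
  have e2 := (tendsto_pow_atTop_atTop_of_one_lt hl₀).eventually (eventually_ge_atTop M)
  obtain ⟨n, hns, hnl, hn⟩ := (e1.and (e2.and (eventually_gt_atTop 0))).exists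
  -- With `s ^ n = 2`, the scale `l` satisfies `H (l ^ n) = H 1 / 2`, which bounds `l ^ n`.
  set s : ℝ := 2 ^ ((n : ℝ)⁻¹) with hs
  have hsn : s ^ n = 2 := Real.rpow_inv_natCast_pow two_pos.le hn.ne'
  have hs1 : 1 < s := Real.one_lt_rpow one_lt_two (by positivity)
  obtain ⟨l, hl, hscale⟩ := h.exists_scale hs1
  have hl0 : 0 < l := one_pos.trans hl
  refine ⟨s, l, hs1, ?_, hl, ?_, hscale⟩
  · by_contra! hle
    have := pow_le_pow_left₀ (one_pos.trans hs₀).le hle n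
    linarith
  · by_contra! hle
    have h1 := pow_le_pow_left₀ (one_pos.trans hl₀).le hle n
    have h2 := scale_pow hl0 (hscale Ψ H h.toTailLimit) one_pos n
    rw [hsn, mul_one] at h2
    have h3 := h.antitoneOn_limit (Set.mem_Ioi.2 (one_pos.trans_le hM1))
      (Set.mem_Ioi.2 (pow_pos hl0 n)) (hnl.trans h1)
    linarith

/-- The limit `H` cannot be constant on an interval, since there are scales `l` arbitrarily close to
`1` for which `H (l u)` is a proper fraction of `H u`. -/
lemma RegularScaling.strictAntiOn (h : RegularScaling b A Ψ H) : StrictAntiOn H (Set.Ioi 0) := by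
  intro u hu v hv huv
  have hu : 0 < u := hu
  obtain ⟨s, l, hs, -, hl, hlv, hscale⟩ := h.exists_small_scale one_lt_two ((one_lt_div hu).2 huv)
  rw [lt_div_iff₀ hu] at hlv
  have h1 := hscale Ψ H h.toTailLimit u hu
  have hlu : 0 < l * u := by positivity
  have h2 := h.pos hlu
  have h3 := h.antitoneOn_limit (Set.mem_Ioi.2 hlu) hv hlv.le
  nlinarith

/-- The limit `H` has no jump at `u`: take `v = u / l` for a scale `l` with factor `s` near `1`. -/
lemma RegularScaling.exists_lt (h : RegularScaling b A Ψ H) {u ε : ℝ} (hu : 0 < u) (hε : 0 < ε) :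
    ∃ v, 0 < v ∧ v < u ∧ H v < H u + ε := by
  have hH := h.pos hu
  obtain ⟨s, l, hs, hs', hl, -, hscale⟩ := h.exists_small_scale
    (show 1 < 1 + ε / H u by linarith [div_pos hε hH]) one_lt_two
  have hl0 : 0 < l := one_pos.trans hl
  have h1 := hscale Ψ H h.toTailLimit (u / l) (div_pos hu hl0)
  rw [mul_div_cancel₀ _ hl0.ne'] at h1
  refine ⟨u / l, div_pos hu hl0, div_lt_self hu hl, ?_⟩
  rw [← h1]
  have := mul_lt_mul_of_pos_right hs' hH
  rwa [add_mul, one_mul, div_mul_cancel₀ _ hH.ne'] at this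

lemma RegularScaling.continuousOn (h : RegularScaling b A Ψ H) : ContinuousOn H (Set.Ioi 0) := by
  intro u hu
  have hu : 0 < u := hu
  refine ContinuousAt.continuousWithinAt ?_
  rw [Metric.continuousAt_iff]
  intro ε hε
  obtain ⟨v, hv0, hvu, hv⟩ := h.exists_lt hu hε
  obtain ⟨w, huw, hw⟩ := h.exists_gt hu hε
  refine ⟨min (u - v) (w - u), lt_min (by linarith) (by linarith), fun {x} hx => ?_⟩
  rw [Real.dist_eq, lt_min_iff, abs_lt, abs_lt] at hx
  have hx0 : 0 < x := by linarith
  have h1 := h.antitoneOn_limit (Set.mem_Ioi.2 hv0) (Set.mem_Ioi.2 hx0) (by linarith)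
  have h2 := h.antitoneOn_limit (Set.mem_Ioi.2 hx0) (Set.mem_Ioi.2 (hu.trans huw)) (by linarith)
  rw [Real.dist_eq, abs_lt]
  constructor <;> linarith

/-- Any two limits of tail functions for the same scaling function are proportional: this holds on
the powers of a scale, and the powers of small scales accumulate at every level from the right. -/
lemma RegularScaling.mul_eq_mul (h : RegularScaling b A Ψ H) (hg : TailLimit b A Φ g) {u : ℝ}
    (hu : 0 < u) : g u * H 1 = g 1 * H u := by
  have hf : ∃ᶠ v in 𝓝[≥] u, g v * H 1 = g 1 * H v := by
    rw [frequently_iff]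
    intro U hU
    obtain ⟨w, huw, hw⟩ := (mem_nhdsGE_iff_exists_Ico_subset' (show u < u + 1 by linarith)).1 hU
    obtain ⟨s, l, hs, -, hl, hlw, hscale⟩ :=
      h.exists_small_scale one_lt_two ((one_lt_div hu).2 huw)
    rw [lt_div_iff₀ hu] at hlw
    have hl0 : 0 < l := one_pos.trans hl
    have hs0 : 0 < s := one_pos.trans hs
    obtain ⟨m, hm1, hm2⟩ := exists_mem_Ioc_zpow hu hl
    refine ⟨l ^ (m + 1), hw ⟨hm2, ?_⟩, ?_⟩
    · rw [zpow_add_one₀ hl0.ne', mul_comm]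
      exact (mul_lt_mul_of_pos_left hm1 hl0).trans hlw
    · have hz : ∀ Φ' g', TailLimit b A Φ' g' → s ^ (m + 1) * g' (l ^ (m + 1)) = g' 1 := by
        intro Φ' g' h'
        rcases Int.eq_nat_or_neg (m + 1) with ⟨n, hn | hn⟩
        · rw [hn]
          simpa using scale_pow hl0 (hscale Φ' g' h') one_pos n
        · have := scale_pow hl0 (hscale Φ' g' h') (u := (l ^ n)⁻¹) (by positivity) n
          rw [mul_inv_cancel₀ (by positivity)] at this
          rw [hn, zpow_neg, zpow_neg, zpow_natCast, zpow_natCast, ← this,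
            inv_mul_cancel_left₀ (by positivity)]
      rw [← hz Φ g hg, ← hz Ψ H h.toTailLimit]
      ring
  exact tendsto_nhds_unique_of_frequently_eq ((hg.right_continuous u hu).mul_const _)
    ((h.right_continuous u hu).const_mul _) hf

end RegularVariation

/-! ### Order statistics -/

section OrderStatistics

/-- The `k+1`-st largest value exceeds `x` if and only if more than `k` of the values do. Ties are
immaterial. -/
lemma lt_descOrderStat_iff {n k : ℕ} (a : Fin n → ℝ) (hk : k < n) (x : ℝ) :
    x < descOrderStat a k ↔ k < (Finset.univ.filter fun i => x < a i).card := by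
  have hcard : (Finset.univ.filter fun i => x < a i).card
      = (Finset.univ.filter fun j => x < a (Tuple.sort a j)).card := by
    refine (Finset.card_bij (fun j _ => Tuple.sort a j) ?_ ?_ ?_).symm
    · intro j hj
      simpa using hj
    · intro i _ j _ hij
      exact (Tuple.sort a).injective hij
    · intro i hi
      exact ⟨(Tuple.sort a).symm i, by simpa using hi, by simp⟩
  have hmono : Monotone (a ∘ Tuple.sort a) := Tuple.monotone_sort a
  have hrev : ((Fin.rev ⟨k, hk⟩ : Fin n) : ℕ) = n - (k + 1) := by simp [Fin.val_rev]
  rw [hcard, descOrderStat, dif_pos hk]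
  constructor
  · intro h
    have hsub : Finset.Ici (Fin.rev ⟨k, hk⟩) ⊆
        Finset.univ.filter fun j => x < a (Tuple.sort a j) := by
      intro j hj
      simp only [Finset.mem_filter, Finset.mem_univ, true_and]
      exact h.trans_le (hmono (Finset.mem_Ici.1 hj))
    have := Finset.card_le_card hsub
    rw [Fin.card_Ici, hrev] at this
    omega
  · intro h
    by_contra! hle
    have hsub : (Finset.univ.filter fun j => x < a (Tuple.sort a j)) ⊆
        Finset.Ioi (Fin.rev ⟨k, hk⟩) := by
      intro j hj
      simp only [Finset.mem_filter, Finset.mem_univ, true_and] at hj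
      rw [Finset.mem_Ioi]
      by_contra! hj'
      exact (hj.trans_le (hmono hj')).not_ge hle
    have := Finset.card_le_card hsub
    rw [Fin.card_Ioi, hrev] at this
    omega

variable {d : ℕ} {p : Seminorm ℝ (Fin d → ℝ)} {F : Set (Fin d → ℝ)}

lemma lt_distOrderStat_iff {n k : ℕ} (hk : k < n) (u : ℝ) (z : ℕ → Fin d → ℝ) :
    u < distOrderStat p F n k z ↔ k < (exceedances p F n u z).card := by
  rw [distOrderStat, lt_descOrderStat_iff _ hk]
  have : exceedances p F n u z = (Finset.univ.filter
      fun i : Fin n => u < normDist p F (z i)).map Fin.valEmbedding := by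
    ext i
    simp only [exceedances, Finset.mem_filter, Finset.mem_range, Finset.mem_map, Finset.mem_univ,
      true_and, Fin.valEmbedding_apply]
    constructor
    · rintro ⟨hi, h⟩
      exact ⟨⟨i, hi⟩, h, rfl⟩
    · rintro ⟨j, h, rfl⟩
      exact ⟨j.2, h⟩
  rw [this, Finset.card_map]

lemma distOrderStat_nonneg (n k : ℕ) (z : ℕ → Fin d → ℝ) : 0 ≤ distOrderStat p F n k z := by
  unfold distOrderStat descOrderStat
  split_ifs
  · exact normDist_nonneg _ _ _
  · exact le_rfl

lemma exceedances_anti {n : ℕ} {u v : ℝ} (h : u ≤ v) (z : ℕ → Fin d → ℝ) :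
    exceedances p F n v z ⊆ exceedances p F n u z :=
  Finset.monotone_filter_right _ fun _ _ hi => h.trans_lt hi

lemma measurable_card_exceedances (hF : IsClosedCone F) {Ω : Type*} [MeasurableSpace Ω]
    {Z : ℕ → Ω → Fin d → ℝ} (hZ : ∀ i, Measurable (Z i)) (n : ℕ) (u : ℝ) :
    Measurable fun ω => (exceedances p F n u fun i => Z i ω).card := by
  simp only [exceedances, Finset.card_filter]
  refine Finset.measurable_sum _ fun i _ => Measurable.ite ?_ measurable_const measurable_const
  exact measurableSet_lt measurable_const ((continuous_normDist p hF).measurable.comp (hZ i))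

lemma measurable_distOrderStat (hF : IsClosedCone F) {Ω : Type*} [MeasurableSpace Ω]
    {Z : ℕ → Ω → Fin d → ℝ} (hZ : ∀ i, Measurable (Z i)) (n k : ℕ) :
    Measurable fun ω => distOrderStat p F n k fun i => Z i ω := by
  by_cases hk : k < n
  · refine measurable_of_Ioi fun x => ?_
    have : (fun ω => distOrderStat p F n k fun i => Z i ω) ⁻¹' Set.Ioi x
        = (fun ω => (exceedances p F n x fun i => Z i ω).card) ⁻¹' Set.Ioi k := by
      ext ω
      exact lt_distOrderStat_iff hk x _
    rw [this]
    exact measurable_card_exceedances hF hZ n x measurableSet_Ioi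
  · simp only [distOrderStat, descOrderStat, dif_neg hk]
    exact measurable_const

end OrderStatistics

/-! ### Convergence in probability -/

section InProbability

variable {Ω : Type*} [MeasurableSpace Ω]

/-- The filter of events `A ⊆ ℕ × Ω` whose sections have probability tending to one (more precisely,
the complements of the sections have outer probability tending to zero). Convergence in probability
of `Y n` to a constant `a` is convergence of the function `(n, ω) ↦ Y n ω` to `a` along this
filter, so that the calculus of limits applies to it. -/
def inProbability (P : Measure Ω) : Filter (ℕ × Ω) where
  sets := {A | Tendsto (fun n => P {ω | (n, ω) ∉ A}) atTop (𝓝 0)}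
  univ_sets := by simp
  sets_of_superset := by
    intro A B hA hAB
    refine tendsto_of_tendsto_of_tendsto_of_le_of_le tendsto_const_nhds hA (fun _ => zero_le)
      fun n => measure_mono fun ω hω hA' => hω (hAB hA')
  inter_sets := by
    intro A B hA hB
    have h : Tendsto (fun n => P {ω | (n, ω) ∉ A} + P {ω | (n, ω) ∉ B}) atTop (𝓝 0) := by
      simpa using hA.add hB
    refine tendsto_of_tendsto_of_tendsto_of_le_of_le tendsto_const_nhds h (fun _ => zero_le)
      fun n => (measure_mono fun ω hω => ?_).trans (measure_union_le _ _)
    by_contra h'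
    simp only [Set.mem_union, Set.mem_ofPred_eq, not_or, not_not] at h'
    exact hω h'

variable {P : Measure Ω}

lemma eventually_inProbability {r : ℕ × Ω → Prop} : (∀ᶠ q in inProbability P, r q) ↔
    Tendsto (fun n => P {ω | ¬ r (n, ω)}) atTop (𝓝 0) := Iff.rfl

lemma tendsto_fst_inProbability (P : Measure Ω) : Tendsto Prod.fst (inProbability P) atTop := by
  intro s hs
  refine eventually_inProbability.2 (tendsto_const_nhds.congr' ?_)
  filter_upwards [hs] with n hn
  simp [hn]

lemma tendsto_inProbability_of_abs {Y : ℕ → Ω → ℝ} {a : ℝ}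
    (h : ∀ ε, 0 < ε → Tendsto (fun n => P {ω | ε ≤ |Y n ω - a|}) atTop (𝓝 0)) :
    Tendsto (fun q : ℕ × Ω => Y q.1 q.2) (inProbability P) (𝓝 a) := by
  rw [Metric.tendsto_nhds]
  intro ε hε
  refine eventually_inProbability.2 ?_
  simpa only [Real.dist_eq, not_lt] using h ε hε

lemma tendsto_measure_of_eventually [IsProbabilityMeasure P] {r : ℕ × Ω → Prop}
    (h : ∀ᶠ q in inProbability P, r q) :
    Tendsto (fun n => P {ω | r (n, ω)}) atTop (𝓝 1) := by
  have h1 : Tendsto (fun n => 1 - P {ω | ¬ r (n, ω)}) atTop (𝓝 1) := by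
    simpa using ENNReal.Tendsto.sub tendsto_const_nhds (eventually_inProbability.1 h)
      (Or.inl ENNReal.one_ne_top)
  refine tendsto_of_tendsto_of_tendsto_of_le_of_le h1 tendsto_const_nhds (fun n => ?_)
    fun n => prob_le_one
  rw [tsub_le_iff_right]
  have : (1 : ℝ≥0∞) = P ({ω | r (n, ω)} ∪ {ω | ¬ r (n, ω)}) := by
    rw [← measure_univ (μ := P)]
    congr 1
    ext ω
    simp [em]
  rw [this]
  exact measure_union_le _ _

/-- Convergence in probability to a constant implies weak convergence. -/
lemma weaklyConvergesTo_of_tendsto [IsProbabilityMeasure P] {E : Type*} [TopologicalSpace E]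
    {X : ℕ → Ω → E} {x : E} (hX : ∀ n, @Measurable _ _ _ (borel E) (X n))
    (h : Tendsto (fun q : ℕ × Ω => X q.1 q.2) (inProbability P) (𝓝 x)) :
    WeaklyConvergesTo P X x := by
  let _ : MeasurableSpace E := borel E
  have : BorelSpace E := ⟨rfl⟩
  refine ⟨fun n => (hX n).aemeasurable, measurable_const.aemeasurable, ?_⟩
  refine tendsto_of_forall_isOpen_le_liminf' fun G hG => ?_
  simp only [ProbabilityMeasure.coe_mk]
  rw [Measure.map_apply measurable_const hG.measurableSet]
  by_cases hx : x ∈ G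
  · have h1 : Tendsto (fun n => (P.map (X n)) G) atTop (𝓝 1) := by
      refine (tendsto_measure_of_eventually (h (hG.mem_nhds hx))).congr fun n => ?_
      rw [Measure.map_apply (hX n) hG.measurableSet]
      rfl
    rw [h1.liminf_eq]
    exact prob_le_one
  · simp [hx]

end InProbability

/-! ### The radial projection onto the unit sphere -/

section SphereProj

variable {d : ℕ} {p : Seminorm ℝ (Fin d → ℝ)} {C F : Set (Fin d → ℝ)}

open Classical in
/-- The radial projection `x ↦ x / d(x, F)` onto the unit sphere, extended to `ℝ^d` by the value `e`
where `x / d(x, F)` is not a point of the sphere. -/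
noncomputable def sphereProj (e : coneSphere p C F) (x : Fin d → ℝ) : coneSphere p C F :=
  if h : (normDist p F x)⁻¹ • x ∈ coneSphere p C F then ⟨(normDist p F x)⁻¹ • x, h⟩ else e

lemma coe_sphereProj (hC : IsClosedCone C) (hF : IsClosedCone F) (e : coneSphere p C F)
    {x : Fin d → ℝ} (hx : x ∈ C) (h : 0 < normDist p F x) :
    (sphereProj e x : Fin d → ℝ) = (normDist p F x)⁻¹ • x := by
  rw [sphereProj, dif_pos (inv_normDist_smul_mem hC hF hx h)]

lemma sphereProj_smul (hF : IsClosedCone F) (e : coneSphere p C F) {t : ℝ} (ht : 0 < t)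
    (x : Fin d → ℝ) : sphereProj e (t • x) = sphereProj e x := by
  have h : (normDist p F (t • x))⁻¹ • (t • x) = (normDist p F x)⁻¹ • x := by
    rw [normDist_smul hF ht, smul_smul, mul_inv, mul_right_comm, inv_mul_cancel₀ ht.ne', one_mul]
  unfold sphereProj
  split_ifs with h1 h2 h2
  · exact Subtype.ext h
  · exact absurd (h ▸ h1) h2
  · exact absurd (h ▸ h2) h1
  · rfl

lemma measurable_sphereProj (hC : IsClosedCone C) (hF : IsClosedCone F) (e : coneSphere p C F) :
    Measurable (sphereProj e) := by
  classical
  have hm : Measurable fun x : Fin d → ℝ => (normDist p F x)⁻¹ • x :=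
    (continuous_normDist p hF).measurable.inv.smul measurable_id
  have hs := measurableSet_coneSphere (p := p) hC hF
  rw [← (MeasurableEmbedding.subtype_coe hs).measurable_comp_iff]
  have : (Subtype.val ∘ sphereProj e) = fun x : Fin d → ℝ =>
      if (normDist p F x)⁻¹ • x ∈ coneSphere p C F then (normDist p F x)⁻¹ • x else e := by
    ext1 x
    simp only [Function.comp_apply, sphereProj]
    split_ifs <;> rfl
  rw [this]
  exact Measurable.ite (hm hs) hm measurable_const

lemma continuous_sphereProj_coe (hp : ∀ x, p x = 0 → x = 0) (hC : IsClosedCone C)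
    (hF : IsClosedCone F) (e : coneSphere p C F) :
    Continuous fun x : openCone C F => sphereProj e (x : Fin d → ℝ) := by
  rw [continuous_induced_rng]
  have : (Subtype.val ∘ fun x : openCone C F => sphereProj e (x : Fin d → ℝ))
      = fun x : openCone C F => (normDist p F (x : Fin d → ℝ))⁻¹ • (x : Fin d → ℝ) := by
    ext1 x
    exact coe_sphereProj hC hF e x.2.1 (normDist_pos hp hF x.2.2)
  rw [this]
  exact (((continuous_normDist p hF).comp continuous_subtype_val).inv₀
    fun x => (normDist_pos hp hF x.2.2).ne').smul continuous_subtype_val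

/-- A unit mass at a point of `s` restricts to a unit mass on the subtype. -/
lemma comap_coe_dirac {α : Type*} [MeasurableSpace α] {s : Set α} (hs : MeasurableSet s) (x : s) :
    (Measure.dirac (x : α)).comap (Subtype.val : s → α) = Measure.dirac x := by
  ext t ht
  rw [(MeasurableEmbedding.subtype_coe hs).comap_apply,
    Measure.dirac_apply' _ ((MeasurableEmbedding.subtype_coe hs).measurableSet_image' ht),
    Measure.dirac_apply' _ ht]
  have h : (x : α) ∈ Subtype.val '' t ↔ x ∈ t := Subtype.val_injective.mem_set_image
  by_cases hx : x ∈ t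
  · rw [Set.indicator_of_mem (h.2 hx), Set.indicator_of_mem hx]
    rfl
  · rw [Set.indicator_of_notMem (mt h.1 hx), Set.indicator_of_notMem hx]

lemma angularMeasure_eq (hC : IsClosedCone C) (hF : IsClosedCone F) (e : coneSphere p C F) (n : ℕ)
    {u : ℝ} (hu : 0 ≤ u) {z : ℕ → Fin d → ℝ} (hz : ∀ i, z i ∈ C) :
    angularMeasure p C F n u z
      = ∑ i ∈ exceedances p F n u z, Measure.dirac (sphereProj e (z i)) := by
  refine Finset.sum_congr rfl fun i hi => ?_
  have h : 0 < normDist p F (z i) := hu.trans_lt (Finset.mem_filter.1 hi).2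
  rw [← coe_sphereProj hC hF e (hz i) h, comap_coe_dirac (measurableSet_coneSphere hC hF)]

lemma spectralMeasure_eq (hC : IsClosedCone C) (hF : IsClosedCone F) (e : coneSphere p C F)
    (ν : Measure (openCone C F)) :
    spectralMeasure p C F ν = (ν {x | 1 ≤ normDist p F (x : Fin d → ℝ)})⁻¹ •
      (ν.restrict {x | 1 ≤ normDist p F (x : Fin d → ℝ)}).map
        fun x : openCone C F => sphereProj e (x : Fin d → ℝ) := by
  have hD : Measurable fun x : openCone C F => normDist p F (x : Fin d → ℝ) :=
    (continuous_normDist p hF).measurable.comp measurable_subtype_coe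
  have hproj : Measurable fun x : openCone C F => sphereProj e (x : Fin d → ℝ) :=
    (measurable_sphereProj hC hF e).comp measurable_subtype_coe
  have hscale : Measurable fun x : openCone C F =>
      (normDist p F (x : Fin d → ℝ))⁻¹ • (x : Fin d → ℝ) := hD.inv.smul measurable_subtype_coe
  have hemb := MeasurableEmbedding.subtype_coe (measurableSet_coneSphere (p := p) hC hF)
  rw [spectralMeasure]
  congr 1
  ext t ht
  rw [hemb.comap_apply, Measure.map_apply hscale
    (hemb.measurableSet_image' ht), Measure.map_apply hproj ht]
  have hset : MeasurableSet {x : openCone C F | 1 ≤ normDist p F (x : Fin d → ℝ)} :=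
    measurableSet_le measurable_const hD
  rw [Measure.restrict_apply' hset, Measure.restrict_apply' hset]
  congr 1
  ext x
  simp only [Set.mem_inter_iff, Set.mem_preimage, Set.mem_ofPred_eq]
  refine and_congr_left fun h1 => ?_
  rw [← coe_sphereProj hC hF e x.2.1 (one_pos.trans_le h1)]
  exact Subtype.val_injective.mem_set_image

end SphereProj

/-! ### Tail integrals -/

section TailIntegral

variable {α : Type*} [MeasurableSpace α]

/-- The integral of `f` over the set where `D > u`, as a function of `u`. -/
noncomputable def tailIntegral (μ : Measure α) (D : α → ℝ) (f : α → ℝ≥0) (u : ℝ) : ℝ :=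
  (∫⁻ x in {x | u < D x}, f x ∂μ).toReal

variable {μ : Measure α} {D : α → ℝ} {f : α → ℝ≥0}

lemma tailIntegral_one (μ : Measure α) (D : α → ℝ) (u : ℝ) :
    tailIntegral μ D 1 u = (μ {x | u < D x}).toReal := by
  simp [tailIntegral]

lemma setLIntegral_lt_top_of_le {s : Set α} (hs : μ s < ∞) {M : ℝ≥0} (hM : ∀ x, f x ≤ M) :
    ∫⁻ x in s, f x ∂μ < ∞ := by
  calc ∫⁻ x in s, f x ∂μ ≤ ∫⁻ _ in s, M ∂μ := lintegral_mono fun x => ENNReal.coe_le_coe.2 (hM x)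
    _ = M * μ s := by simp
    _ < ∞ := ENNReal.mul_lt_top ENNReal.coe_lt_top hs

lemma tailIntegral_anti {u v : ℝ} (huv : u ≤ v) (h : ∫⁻ x in {x | u < D x}, f x ∂μ < ∞) :
    tailIntegral μ D f v ≤ tailIntegral μ D f u :=
  ENNReal.toReal_mono h.ne (lintegral_mono_set fun _ hx => huv.trans_lt hx)

lemma continuousWithinAt_tailIntegral (hD : Measurable D) {u : ℝ}
    (h : ∫⁻ x in {x | u < D x}, f x ∂μ < ∞) :
    ContinuousWithinAt (tailIntegral μ D f) (Set.Ici u) u := by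
  refine (ENNReal.tendsto_toReal h.ne).comp ?_
  set κ := μ.withDensity fun x => (f x : ℝ≥0∞)
  have hκ : ∀ v, ∫⁻ x in {x | v < D x}, f x ∂μ = κ {x | v < D x} := fun v =>
    (withDensity_apply _ (measurableSet_lt measurable_const hD)).symm
  simp only [hκ]
  have hseq : Tendsto (fun n : ℕ => κ {x | u + 1 / ((n : ℝ) + 1) < D x}) atTop
      (𝓝 (κ {x | u < D x})) := by
    have hU : {x | u < D x} = ⋃ n : ℕ, {x | u + 1 / ((n : ℝ) + 1) < D x} := by
      ext x
      simp only [Set.mem_ofPred_eq, Set.mem_iUnion]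
      constructor
      · intro hx
        obtain ⟨n, hn⟩ := exists_nat_one_div_lt (sub_pos.2 hx)
        exact ⟨n, by linarith⟩
      · rintro ⟨n, hn⟩
        have : 0 < 1 / ((n : ℝ) + 1) := by positivity
        linarith
    rw [hU]
    refine tendsto_measure_iUnion_atTop fun m n hmn x hx => ?_
    have : 1 / ((n : ℝ) + 1) ≤ 1 / ((m : ℝ) + 1) := Nat.one_div_le_one_div hmn
    simp only [Set.mem_ofPred_eq] at hx ⊢
    linarith
  refine tendsto_order.2 ⟨fun c hc => ?_, fun c hc => ?_⟩
  · obtain ⟨n, hn⟩ := (hseq.eventually (lt_mem_nhds hc)).exists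
    have hlt : u < u + 1 / ((n : ℝ) + 1) := lt_add_of_pos_right _ (by positivity)
    filter_upwards [nhdsWithin_le_nhds (Iio_mem_nhds hlt)] with v hv
    exact hn.trans_le (measure_mono fun x hx => show v < D x from lt_trans hv hx)
  · filter_upwards [self_mem_nhdsWithin] with v hv
    exact (measure_mono fun x hx => show u < D x from lt_of_le_of_lt hv hx).trans_lt hc

lemma tendsto_tailIntegral_atTop (hD : Measurable D) {u : ℝ}
    (h : ∫⁻ x in {x | u < D x}, f x ∂μ < ∞) :
    Tendsto (tailIntegral μ D f) atTop (𝓝 0) := by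
  rw [← ENNReal.toReal_zero]
  refine (ENNReal.tendsto_toReal ENNReal.zero_ne_top).comp ?_
  set κ := μ.withDensity fun x => (f x : ℝ≥0∞)
  have hκ : ∀ v, ∫⁻ x in {x | v < D x}, f x ∂μ = κ {x | v < D x} := fun v =>
    (withDensity_apply _ (measurableSet_lt measurable_const hD)).symm
  rw [hκ] at h
  simp only [hκ]
  have hI : ⋂ v : ℝ, {x | v < D x} = ∅ := by
    ext x
    simp only [Set.mem_iInter, Set.mem_ofPred_eq, Set.mem_empty_iff_false, iff_false, not_forall]
    exact ⟨D x, lt_irrefl _⟩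
  rw [← measure_empty (μ := κ), ← hI]
  exact tendsto_measure_iInter_atTop
    (fun v => (measurableSet_lt measurable_const hD).nullMeasurableSet)
    (fun v w hvw x hx => lt_of_le_of_lt hvw hx) ⟨u, h.ne⟩

end TailIntegral

/-! ### Tail limits of a regularly varying vector -/

section TailLimits

variable {d : ℕ} {p : Seminorm ℝ (Fin d → ℝ)} {C F : Set (Fin d → ℝ)} {Ω : Type*}
  [MeasurableSpace Ω] {P : Measure Ω} {Z : Ω → Fin d → ℝ} {b : ℝ → ℝ} {ν : Measure (openCone C F)}

/-- The distance to `F` as a function on the open cone. -/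
noncomputable def coneDist (p : Seminorm ℝ (Fin d → ℝ)) (C F : Set (Fin d → ℝ))
    (x : openCone C F) : ℝ :=
  normDist p F (x : Fin d → ℝ)

/-- The radial projection as a function on the open cone. -/
noncomputable def coneProj (e : coneSphere p C F) (x : openCone C F) : coneSphere p C F :=
  sphereProj e (x : Fin d → ℝ)

lemma continuous_coneDist (hF : IsClosedCone F) : Continuous (coneDist p C F) :=
  (continuous_normDist p hF).comp continuous_subtype_val

/-- The levels `u` at which the limit measure does not charge `{x : d(x, F) = u}`. -/
def regularLevels (p : Seminorm ℝ (Fin d → ℝ)) (C F : Set (Fin d → ℝ))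
    (ν : Measure (openCone C F)) : Set ℝ :=
  {u | 0 < u ∧ ν {x | coneDist p C F x = u} = 0}

lemma InMStar.measure_lt_top (hν : InMStar p C F ν) {u : ℝ} (hu : 0 < u) :
    ν {x | u < coneDist p C F x} < ∞ :=
  (measure_mono fun x (hx : u < coneDist p C F x) => show u ≤ _ from hx.le).trans_lt (hν u hu)

lemma exists_mem_regularLevels (hF : IsClosedCone F) (hν : InMStar p C F ν) {u v : ℝ} (hu : 0 < u)
    (huv : u < v) : ∃ w ∈ regularLevels p C F ν, u < w ∧ w < v := by
  have hD := (continuous_coneDist (p := p) (C := C) hF).measurable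
  have : IsFiniteMeasure (ν.restrict {x | u < coneDist p C F x}) :=
    ⟨by simpa using hν.measure_lt_top hu⟩
  have hc := Measure.countable_meas_level_set_pos (μ := ν.restrict {x | u < coneDist p C F x}) hD
  obtain ⟨w, hw, huw, hwv⟩ := (hc.dense_compl ℝ).exists_between huv
  refine ⟨w, ⟨hu.trans huw, ?_⟩, huw, hwv⟩
  simp only [Set.mem_compl_iff, Set.mem_ofPred_eq, not_lt, nonpos_iff_eq_zero] at hw
  have hs : MeasurableSet {x | coneDist p C F x = w} := hD (measurableSet_singleton w)
  rw [Measure.restrict_apply hs] at hw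
  refine measure_mono_null ?_ hw
  rintro x (hx : coneDist p C F x = w)
  exact ⟨hx, huw.trans_eq hx.symm⟩

lemma scaledTailLaw_apply (hC : IsClosedCone C) (hF : IsClosedCone F) (hZ : Measurable Z)
    (hZC : ∀ ω, Z ω ∈ C) (e : coneSphere p C F) {U : Set (coneSphere p C F)} (hU : MeasurableSet U)
    {t β u : ℝ} (hβ : 0 < β) (hu : 0 < u) :
    scaledTailLaw P C F Z t β {x | u < coneDist p C F x ∧ coneProj e x ∈ U}
      = ENNReal.ofReal t *
        P {ω | u * β < normDist p F (Z ω) ∧ sphereProj e (Z ω) ∈ U} := by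
  have hO : MeasurableSet (openCone C F) := hC.isClosed.measurableSet.diff hF.isClosed.measurableSet
  have hemb := MeasurableEmbedding.subtype_coe hO
  have hB : MeasurableSet {x : openCone C F | u < coneDist p C F x ∧ coneProj e x ∈ U} :=
    (measurableSet_lt measurable_const (continuous_coneDist hF).measurable).inter
      (((measurable_sphereProj hC hF e).comp measurable_subtype_coe) hU)
  have hm : Measurable fun ω => β⁻¹ • Z ω := hZ.const_smul β⁻¹
  rw [scaledTailLaw, Measure.smul_apply, smul_eq_mul, hemb.comap_apply,
    Measure.map_apply hm (hemb.measurableSet_image' hB)]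
  congr 2
  ext ω
  have hβ' := inv_pos.2 hβ
  have h1 : u * β < normDist p F (Z ω) ↔ u < normDist p F (β⁻¹ • Z ω) := by
    rw [normDist_smul hF hβ', inv_mul_eq_div, lt_div_iff₀ hβ]
  have h2 := sphereProj_smul hF e hβ' (Z ω)
  simp only [Set.mem_preimage, Set.mem_image, Set.mem_ofPred_eq, h1, ← h2]
  constructor
  · rintro ⟨x, hx, h⟩
    rw [← h]
    exact hx
  · intro h
    exact ⟨⟨β⁻¹ • Z ω, mem_openCone_of_normDist_pos (p := p) (hC.smul_mem _ (hZC ω) _ hβ')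
      (hu.trans h.1)⟩, h, rfl⟩

/-- Convergence on the set of points beyond the level `u` with direction in `U`. Its boundary is
contained in the union of `{x : d(x, F) = u}` and the set of points with direction in the boundary
of `U`. -/
lemma tendsto_tail_prob (hp : ∀ x, p x = 0 → x = 0) (hC : IsClosedCone C) (hF : IsClosedCone F)
    (hZ : Measurable Z) (hZC : ∀ ω, Z ω ∈ C) (hRV : IsRegularlyVarying P p C F Z b ν)
    (e : coneSphere p C F) {u : ℝ} (hu : u ∈ regularLevels p C F ν) {U : Set (coneSphere p C F)}
    (hU : IsOpen U) (hfr : ν ({x | u ≤ coneDist p C F x} ∩ coneProj e ⁻¹' frontier U) = 0) :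
    Tendsto (fun t => ENNReal.ofReal t *
        P {ω | u * b t < normDist p F (Z ω) ∧ sphereProj e (Z ω) ∈ U}) atTop
      (𝓝 (ν {x | u < coneDist p C F x ∧ coneProj e x ∈ U})) := by
  have hD := continuous_coneDist (p := p) (C := C) hF
  have hθ : Continuous (coneProj e) := continuous_sphereProj_coe hp hC hF e
  set B : Set (openCone C F) := {x | u < coneDist p C F x ∧ coneProj e x ∈ U} with hB
  have hBo : IsOpen B := (isOpen_lt continuous_const hD).inter (hU.preimage hθ)
  have hcl : closure B ⊆ {x | u ≤ coneDist p C F x} ∩ coneProj e ⁻¹' closure U := by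
    refine closure_minimal (fun x hx => ⟨show u ≤ _ from hx.1.le, subset_closure hx.2⟩) ?_
    exact (isClosed_le continuous_const hD).inter (isClosed_closure.preimage hθ)
  have hνB : ν (frontier B) = 0 := by
    refine measure_mono_null ?_ (measure_union_null hu.2 hfr)
    intro x hx
    rw [hBo.frontier_eq] at hx
    obtain ⟨hx1, hx2⟩ := hcl hx.1
    have hx1 : u ≤ coneDist p C F x := hx1
    rcases hx1.eq_or_lt with h | h
    · exact Or.inl h.symm
    · refine Or.inr ⟨hx1, ?_⟩
      rw [Set.mem_preimage, hU.frontier_eq]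
      exact ⟨hx2, fun h' => hx.2 ⟨h, h'⟩⟩
  refine (hRV.tendsto_tail B hBo.measurableSet ⟨u, hu.1, fun x hx => hx.1.le⟩ hνB).congr' ?_
  filter_upwards [hRV.tendsto_scaling.eventually (eventually_gt_atTop 0)] with t ht
  exact scaledTailLaw_apply hC hF hZ hZC e hU.measurableSet ht hu.1

/-- The convergence of measures in `𝕄*(C, 𝕆)`, integrated against functions of the direction. By the
layer cake formula it follows from the convergence of the measures of the superlevel sets. -/
lemma tendsto_tail_lintegral (hp : ∀ x, p x = 0 → x = 0) (hC : IsClosedCone C)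
    (hF : IsClosedCone F) (hZ : Measurable Z) (hZC : ∀ ω, Z ω ∈ C)
    (hRV : IsRegularlyVarying P p C F Z b ν) (e : coneSphere p C F) (f : coneSphere p C F →ᵇ ℝ≥0)
    {u : ℝ} (hu : u ∈ regularLevels p C F ν) :
    Tendsto (fun t => ENNReal.ofReal t *
        ∫⁻ ω in {ω | u * b t < normDist p F (Z ω)}, f (sphereProj e (Z ω)) ∂P) atTop
      (𝓝 (∫⁻ x in {x | u < coneDist p C F x}, f (coneProj e x) ∂ν)) := by
  have hD := continuous_coneDist (p := p) (C := C) hF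
  have hθ : Continuous (coneProj e) := continuous_sphereProj_coe hp hC hF e
  have hfθ : Measurable fun x => (f (coneProj e x) : ℝ) :=
    (NNReal.continuous_coe.comp (f.continuous.comp hθ)).measurable
  have hfZ : Measurable fun ω => (f (sphereProj e (Z ω)) : ℝ) :=
    (NNReal.continuous_coe.comp f.continuous).measurable.comp
      ((measurable_sphereProj hC hF e).comp hZ)
  have hDZ : Measurable fun ω => normDist p F (Z ω) := (continuous_normDist p hF).measurable.comp hZ
  have lc1 : ∀ t : ℝ, ∫⁻ ω in {ω | u * b t < normDist p F (Z ω)}, f (sphereProj e (Z ω)) ∂P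
      = ∫⁻ a in Set.Ioi 0,
          P {ω | u * b t < normDist p F (Z ω) ∧ a < (f (sphereProj e (Z ω)) : ℝ)} := by
    intro t
    have h := lintegral_eq_lintegral_meas_lt (P.restrict {ω | u * b t < normDist p F (Z ω)})
      (Eventually.of_forall fun ω => (f (sphereProj e (Z ω))).coe_nonneg) hfZ.aemeasurable
    simp only [ENNReal.ofReal_coe_nnreal] at h
    rw [h]
    refine lintegral_congr fun a => ?_
    rw [Measure.restrict_apply (measurableSet_lt measurable_const hfZ), Set.inter_comm]
    rfl
  have lc2 : ∫⁻ x in {x | u < coneDist p C F x}, f (coneProj e x) ∂ν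
      = ∫⁻ a in Set.Ioi 0, ν {x | u < coneDist p C F x ∧ a < (f (coneProj e x) : ℝ)} := by
    have h := lintegral_eq_lintegral_meas_lt (ν.restrict {x | u < coneDist p C F x})
      (Eventually.of_forall fun x => (f (coneProj e x)).coe_nonneg) hfθ.aemeasurable
    simp only [ENNReal.ofReal_coe_nnreal] at h
    rw [h]
    refine lintegral_congr fun a => ?_
    rw [Measure.restrict_apply (measurableSet_lt measurable_const hfθ), Set.inter_comm]
    rfl
  have hmeas : ∀ t : ℝ, Measurable fun a : ℝ =>
      P {ω | u * b t < normDist p F (Z ω) ∧ a < (f (sphereProj e (Z ω)) : ℝ)} := fun t =>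
    Antitone.measurable fun a a' h => measure_mono fun ω hω => ⟨hω.1, h.trans_lt hω.2⟩
  simp only [lc1, lc2]
  simp only [← lintegral_const_mul _ (hmeas _)]
  -- The total masses converge, which bounds the superlevel sets uniformly in `t`.
  have htot := tendsto_tail_prob hp hC hF hZ hZC hRV e hu isOpen_univ (by simp)
  simp only [Set.mem_univ, and_true] at htot
  have hfin := hRV.inMStar.measure_lt_top hu.1
  obtain ⟨K, hK1, hK⟩ : ∃ K : ℝ≥0∞, ν {x | u < coneDist p C F x} < K ∧ K < ∞ := exists_between hfin
  obtain ⟨M, hM⟩ : ∃ M : ℝ, ∀ y, (f y : ℝ) ≤ M :=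
    ⟨nndist f 0, fun y => NNReal.coe_le_coe.2 (BoundedContinuousFunction.NNReal.upper_bound f y)⟩
  refine tendsto_lintegral_filter_of_dominated_convergence ((Set.Iio M).indicator fun _ => K)
    (Eventually.of_forall fun t => (hmeas t).const_mul _) ?_ ?_ ?_
  · filter_upwards [htot.eventually (gt_mem_nhds hK1)] with t ht
    refine Eventually.of_forall fun a => ?_
    by_cases ha : a < M
    · rw [Set.indicator_of_mem (Set.mem_Iio.2 ha)]
      refine le_trans ?_ ht.le
      gcongr
      exact fun hω => hω.1
    · have : {ω | u * b t < normDist p F (Z ω) ∧ a < (f (sphereProj e (Z ω)) : ℝ)} = ∅ := by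
        ext ω
        simp only [Set.mem_ofPred_eq, Set.mem_empty_iff_false, iff_false, not_and, not_lt]
        exact fun _ => (hM _).trans (not_lt.1 ha)
      rw [this]
      simp
  · rw [lintegral_indicator measurableSet_Iio, setLIntegral_const,
      Measure.restrict_apply measurableSet_Iio, Set.Iio_inter_Ioi]
    exact ENNReal.mul_ne_top hK.ne (by simp)
  · have : IsFiniteMeasure (ν.restrict {x | u ≤ coneDist p C F x}) :=
      ⟨by simpa [coneDist] using hRV.inMStar u hu.1⟩
    -- All but countably many levels `a` of `f` are null sets of the limit measure.
    have hc := Measure.countable_meas_level_set_pos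
      (μ := ν.restrict {x | u ≤ coneDist p C F x}) hfθ
    filter_upwards [ae_restrict_of_ae (hc.ae_notMem volume)] with a ha
    simp only [not_lt, nonpos_iff_eq_zero] at ha
    have hs : MeasurableSet {x | (f (coneProj e x) : ℝ) = a} := hfθ (measurableSet_singleton a)
    rw [Measure.restrict_apply hs] at ha
    have hfc : Continuous fun y => (f y : ℝ) := NNReal.continuous_coe.comp f.continuous
    refine tendsto_tail_prob hp hC hF hZ hZC hRV e hu (U := {y | a < (f y : ℝ)})
      (isOpen_lt continuous_const hfc) (measure_mono_null ?_ ha)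
    rintro x ⟨hx1, hx2⟩
    exact ⟨Eq.symm (frontier_lt_subset_eq continuous_const hfc hx2), hx1⟩

lemma tailLimit_of_isRegularlyVarying [IsProbabilityMeasure P] (hp : ∀ x, p x = 0 → x = 0)
    (hC : IsClosedCone C) (hF : IsClosedCone F) (hZ : Measurable Z) (hZC : ∀ ω, Z ω ∈ C)
    (hRV : IsRegularlyVarying P p C F Z b ν) (e : coneSphere p C F)
    (f : coneSphere p C F →ᵇ ℝ≥0) :
    TailLimit b (regularLevels p C F ν)
      (tailIntegral P (fun ω => normDist p F (Z ω)) fun ω => f (sphereProj e (Z ω)))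
      (tailIntegral ν (coneDist p C F) fun x => f (coneProj e x)) := by
  have hD := (continuous_coneDist (p := p) (C := C) hF).measurable
  obtain ⟨M, hM⟩ : ∃ M : ℝ≥0, ∀ y, f y ≤ M :=
    ⟨nndist f 0, BoundedContinuousFunction.NNReal.upper_bound f⟩
  have hfin : ∀ u, 0 < u → ∫⁻ x in {x | u < coneDist p C F x}, f (coneProj e x) ∂ν < ∞ :=
    fun u hu => setLIntegral_lt_top_of_le (hRV.inMStar.measure_lt_top hu) fun x => hM _
  refine ⟨fun u v huv => tailIntegral_anti huv
    (setLIntegral_lt_top_of_le (measure_lt_top P _) fun ω => hM _), ?_, ?_, ?_⟩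
  · exact fun u hu v _ huv => tailIntegral_anti huv (hfin u hu)
  · exact fun u hu => continuousWithinAt_tailIntegral hD (hfin u hu)
  · intro u hu
    refine ((ENNReal.tendsto_toReal (hfin u hu.1).ne).comp
      (tendsto_tail_lintegral hp hC hF hZ hZC hRV e f hu)).congr' ?_
    filter_upwards [eventually_ge_atTop 0] with t ht
    simp [tailIntegral, ENNReal.toReal_ofReal ht]

lemma regularScaling_of_isRegularlyVarying [IsProbabilityMeasure P] (hp : ∀ x, p x = 0 → x = 0)
    (hC : IsClosedCone C) (hF : IsClosedCone F) (hZ : Measurable Z) (hZC : ∀ ω, Z ω ∈ C)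
    (hRV : IsRegularlyVarying P p C F Z b ν) (e : coneSphere p C F) :
    RegularScaling b (regularLevels p C F ν)
      (tailIntegral P (fun ω => normDist p F (Z ω)) 1) (tailIntegral ν (coneDist p C F) 1) := by
  have hD := (continuous_coneDist (p := p) (C := C) hF).measurable
  refine ⟨tailLimit_of_isRegularlyVarying hp hC hF hZ hZC hRV e 1, hRV.monotone_scaling,
    hRV.tendsto_scaling, fun u v hu huv => exists_mem_regularLevels hF hRV.inMStar hu huv, ?_, ?_⟩
  · refine tendsto_tailIntegral_atTop hD (u := 1) ?_
    exact setLIntegral_lt_top_of_le (hRV.inMStar.measure_lt_top one_pos) (M := 1) fun x => le_rfl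
  · by_contra! h
    refine hRV.ne_zero (Measure.measure_univ_eq_zero.1 ?_)
    have hU : (Set.univ : Set (openCone C F))
        = ⋃ n : ℕ, {x | 1 / ((n : ℝ) + 1) < coneDist p C F x} := by
      ext x
      simp only [Set.mem_univ, Set.mem_iUnion, Set.mem_ofPred_eq, true_iff]
      exact exists_nat_one_div_lt (normDist_pos hp hF x.2.2)
    rw [hU, measure_iUnion_null_iff]
    intro n
    have hpos : 0 < 1 / ((n : ℝ) + 1) := by positivity
    have := h _ hpos
    rw [tailIntegral_one] at this
    exact ((ENNReal.toReal_eq_zero_iff _).1 (this.antisymm ENNReal.toReal_nonneg)).resolve_right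
      (hRV.inMStar.measure_lt_top hpos).ne

/-- Continuity of the tail function of the limit measure excludes atoms of the distance. -/
lemma mem_regularLevels [IsProbabilityMeasure P] (hp : ∀ x, p x = 0 → x = 0)
    (hC : IsClosedCone C) (hF : IsClosedCone F) (hZ : Measurable Z) (hZC : ∀ ω, Z ω ∈ C)
    (hRV : IsRegularlyVarying P p C F Z b ν) (e : coneSphere p C F) {u : ℝ} (hu : 0 < u) :
    u ∈ regularLevels p C F ν := by
  have hD := (continuous_coneDist (p := p) (C := C) hF).measurable
  refine ⟨hu, ?_⟩
  by_contra hne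
  have hlt : ν {x | coneDist p C F x = u} ≠ ∞ :=
    ((measure_mono fun x (hx : coneDist p C F x = u) => show u ≤ _ from hx.ge).trans_lt
      (hRV.inMStar u hu)).ne
  obtain ⟨v, hv0, hvu, hv⟩ := (regularScaling_of_isRegularlyVarying hp hC hF hZ hZC hRV
    e).exists_lt hu (ENNReal.toReal_pos hne hlt)
  refine hv.not_ge ?_
  have hs : MeasurableSet {x | coneDist p C F x = u} := hD (measurableSet_singleton u)
  rw [tailIntegral_one, tailIntegral_one,
    ← ENNReal.toReal_add (hRV.inMStar.measure_lt_top hu).ne hlt, ← measure_union _ hs]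
  · refine ENNReal.toReal_mono (hRV.inMStar.measure_lt_top hv0).ne (measure_mono ?_)
    rintro x (hx | hx)
    · exact hvu.trans hx
    · exact hvu.trans_eq (Eq.symm hx)
  · rw [Set.disjoint_left]
    intro x (hx : u < _) (hx' : _ = u)
    exact hx.ne' hx'

end TailLimits

/-! ### A weak law of large numbers for triangular arrays -/

section WeakLaw

variable {Ω : Type*} [MeasurableSpace Ω] {P : Measure Ω} [IsProbabilityMeasure P]

/-- Chebyshev's inequality for a sum of independent copies of `φ (Z 0)`, with the variance bounded
by means of `φ ^ 2 ≤ M φ`. -/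
lemma measure_abs_sum_sub_le {X : Type*} [MeasurableSpace X] {Z : ℕ → Ω → X}
    (hZ : ∀ i, Measurable (Z i)) (hindep : iIndepFun Z P)
    (hident : ∀ i, IdentDistrib (Z i) (Z 0) P P) {φ : X → ℝ} (hφ : Measurable φ)
    (h0 : ∀ x, 0 ≤ φ x) {M : ℝ} (hM : ∀ x, φ x ≤ M) (n : ℕ) {c : ℝ} (hc : 0 < c) :
    P {ω | c ≤ |∑ i ∈ Finset.range n, φ (Z i ω) - n * ∫ ω, φ (Z 0 ω) ∂P|}
      ≤ ENNReal.ofReal (n * (M * ∫ ω, φ (Z 0 ω) ∂P) / c ^ 2) := by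
  set Y : ℕ → Ω → ℝ := fun i ω => φ (Z i ω) with hY
  have hYm : ∀ i, Measurable (Y i) := fun i => hφ.comp (hZ i)
  have hid : ∀ i, IdentDistrib (Y i) (Y 0) P P := fun i => (hident i).comp hφ
  have hL2 : ∀ i, MemLp (Y i) 2 P := fun i => by
    refine MemLp.of_bound (hYm i).aestronglyMeasurable M (Eventually.of_forall fun ω => ?_)
    rw [Real.norm_of_nonneg (h0 _)]
    exact hM _
  have hint : ∀ i, Integrable (Y i) P := fun i => (hL2 i).integrable one_le_two
  have hE : ∫ ω, (∑ i ∈ Finset.range n, Y i) ω ∂P = n * ∫ ω, Y 0 ω ∂P := by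
    simp only [Finset.sum_apply]
    rw [integral_finsetSum _ fun i _ => hint i]
    simp [fun i => (hid i).integral_eq]
  have hvar : variance (∑ i ∈ Finset.range n, Y i) P ≤ n * (M * ∫ ω, Y 0 ω ∂P) := by
    have hind : iIndepFun Y P := hindep.comp _ fun _ => hφ
    rw [IndepFun.variance_sum (fun i _ => hL2 i) fun i _ j _ hij => hind.indepFun hij]
    simp only [fun i => (hid i).variance_eq, Finset.sum_const, Finset.card_range, nsmul_eq_mul]
    refine mul_le_mul_of_nonneg_left ?_ (Nat.cast_nonneg n)
    refine (variance_le_expectation_sq (hYm 0).aestronglyMeasurable).trans ?_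
    rw [← integral_const_mul]
    refine integral_mono (hL2 0).integrable_sq ((hint 0).const_mul M) fun ω => ?_
    simp only [Pi.pow_apply, sq]
    exact mul_le_mul_of_nonneg_right (hM _) (h0 _)
  have hS : MemLp (∑ i ∈ Finset.range n, Y i) 2 P := memLp_finsetSum' _ fun i _ => hL2 i
  have := meas_ge_le_variance_div_sq hS hc
  rw [hE] at this
  simp only [Finset.sum_apply] at this
  refine this.trans (ENNReal.ofReal_le_ofReal ?_)
  gcongr

/-- If the means of the sums of `n` independent copies of `φ n (Z 0)`, divided by `k n`, converge,
then so do the sums themselves, in probability: their variances are of the order `1 / k n`. -/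
lemma tendsto_sum_inProbability {X : Type*} [MeasurableSpace X] {Z : ℕ → Ω → X}
    (hZ : ∀ i, Measurable (Z i)) (hindep : iIndepFun Z P)
    (hident : ∀ i, IdentDistrib (Z i) (Z 0) P P) {φ : ℕ → X → ℝ} (hφ : ∀ n, Measurable (φ n))
    (h0 : ∀ n x, 0 ≤ φ n x) {M : ℝ} (hM : ∀ n x, φ n x ≤ M) {k : ℕ → ℕ}
    (hk : Tendsto k atTop atTop) {m : ℝ}
    (hm : Tendsto (fun n : ℕ => (n : ℝ) / k n * ∫ ω, φ n (Z 0 ω) ∂P) atTop (𝓝 m)) :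
    Tendsto (fun q : ℕ × Ω => (k q.1 : ℝ)⁻¹ * ∑ i ∈ Finset.range q.1, φ q.1 (Z i q.2))
      (inProbability P) (𝓝 m) := by
  have hfluct : Tendsto (fun q : ℕ × Ω => (k q.1 : ℝ)⁻¹ * ∑ i ∈ Finset.range q.1, φ q.1 (Z i q.2)
      - (q.1 : ℝ) / k q.1 * ∫ ω, φ q.1 (Z 0 ω) ∂P) (inProbability P) (𝓝 0) := by
    refine tendsto_inProbability_of_abs (Y := fun n ω =>
      (k n : ℝ)⁻¹ * ∑ i ∈ Finset.range n, φ n (Z i ω) - (n : ℝ) / k n * ∫ ω, φ n (Z 0 ω) ∂P)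
      fun ε hε => ?_
    have hkr : Tendsto (fun n => ((k n : ℝ))⁻¹) atTop (𝓝 0) :=
      tendsto_inv_atTop_zero.comp (tendsto_natCast_atTop_atTop.comp hk)
    have hbound : Tendsto (fun n : ℕ => ENNReal.ofReal (M / ε ^ 2 * ((k n : ℝ)⁻¹ *
        ((n : ℝ) / k n * ∫ ω, φ n (Z 0 ω) ∂P)))) atTop (𝓝 0) := by
      have := ENNReal.tendsto_ofReal ((hkr.mul hm).const_mul (M / ε ^ 2))
      simpa using this
    refine tendsto_of_tendsto_of_tendsto_of_le_of_le' tendsto_const_nhds hbound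
      (Eventually.of_forall fun _ => zero_le) ?_
    filter_upwards [hk.eventually (eventually_gt_atTop 0)] with n hn
    have hkn : (0 : ℝ) < k n := Nat.cast_pos.2 hn
    have h := measure_abs_sum_sub_le hZ hindep hident (hφ n) (h0 n) (hM n) n (mul_pos hkn hε)
    refine le_trans (measure_mono fun ω hω => ?_) (h.trans_eq ?_)
    · simp only [Set.mem_ofPred_eq, sub_zero] at hω ⊢
      have heq : (k n : ℝ)⁻¹ * ∑ i ∈ Finset.range n, φ n (Z i ω)
          - (n : ℝ) / k n * ∫ ω, φ n (Z 0 ω) ∂P = (k n : ℝ)⁻¹ *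
          (∑ i ∈ Finset.range n, φ n (Z i ω) - n * ∫ ω, φ n (Z 0 ω) ∂P) := by
        field_simp
      rw [heq, abs_mul, abs_of_pos (inv_pos.2 hkn), inv_mul_eq_div, le_div_iff₀ hkn] at hω
      linarith
    · congr 1
      field_simp
  simpa using hfluct.add (hm.comp (tendsto_fst_inProbability P))

end WeakLaw

/-! ### Sums over exceedances of deterministic and random thresholds -/

section Exceedances

variable {d : ℕ} {p : Seminorm ℝ (Fin d → ℝ)} {C F : Set (Fin d → ℝ)} {Ω : Type*}
  [MeasurableSpace Ω] {P : Measure Ω} [IsProbabilityMeasure P] {Z : ℕ → Ω → Fin d → ℝ}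
  {b : ℝ → ℝ} {ν : Measure (openCone C F)} {k : ℕ → ℕ}

/-- The sum `k⁻¹ ∑ f(z i / d(z i, F))` over the `i < n` with `d(z i, F) > u`. -/
noncomputable def exceedanceSum (e : coneSphere p C F) (f : coneSphere p C F → ℝ≥0) (n k : ℕ)
    (u : ℝ) (z : ℕ → Fin d → ℝ) : ℝ :=
  (k : ℝ)⁻¹ * ∑ i ∈ exceedances p F n u z, (f (sphereProj e (z i)) : ℝ)

lemma exceedanceSum_anti (e : coneSphere p C F) (f : coneSphere p C F → ℝ≥0) (n k : ℕ) {u v : ℝ}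
    (h : u ≤ v) (z : ℕ → Fin d → ℝ) : exceedanceSum e f n k v z ≤ exceedanceSum e f n k u z :=
  mul_le_mul_of_nonneg_left
    (Finset.sum_le_sum_of_subset_of_nonneg (exceedances_anti h z) fun _ _ _ => NNReal.coe_nonneg _)
    (by positivity)

lemma exceedanceSum_one (e : coneSphere p C F) (n k : ℕ) (u : ℝ) (z : ℕ → Fin d → ℝ) :
    exceedanceSum e 1 n k u z = (k : ℝ)⁻¹ * (exceedances p F n u z).card := by
  simp [exceedanceSum]

lemma tendsto_exceedanceSum (hp : ∀ x, p x = 0 → x = 0) (hC : IsClosedCone C)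
    (hF : IsClosedCone F) (hZ : ∀ i, Measurable (Z i)) (hZC : ∀ i ω, Z i ω ∈ C)
    (hindep : iIndepFun Z P) (hident : ∀ i, IdentDistrib (Z i) (Z 0) P P)
    (hRV : IsRegularlyVarying P p C F (Z 0) b ν) (hk : Tendsto k atTop atTop)
    (hnk : Tendsto (fun n : ℕ => (n : ℝ) / (k n : ℝ)) atTop atTop) (e : coneSphere p C F)
    (f : coneSphere p C F →ᵇ ℝ≥0) {u : ℝ} (hu : 0 < u) :
    Tendsto (fun q : ℕ × Ω =>
        exceedanceSum e f q.1 (k q.1) (u * b ((q.1 : ℝ) / k q.1)) fun i => Z i q.2)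
      (inProbability P) (𝓝 (tailIntegral ν (coneDist p C F) (fun x => f (coneProj e x)) u)) := by
  have hDm : Measurable (normDist p F) := (continuous_normDist p hF).measurable
  have hfm : Measurable fun z => (f (sphereProj e z) : ℝ) :=
    (NNReal.continuous_coe.comp f.continuous).measurable.comp (measurable_sphereProj hC hF e)
  have hs : ∀ v : ℝ, MeasurableSet {z | v < normDist p F z} := fun v =>
    measurableSet_lt measurable_const hDm
  have hlim := ((tailLimit_of_isRegularlyVarying hp hC hF (hZ 0) (hZC 0) hRV e f).tendsto u
    (mem_regularLevels hp hC hF (hZ 0) (hZC 0) hRV e hu)).comp hnk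
  have h := tendsto_sum_inProbability hZ hindep hident
    (φ := fun n => {z | u * b ((n : ℝ) / k n) < normDist p F z}.indicator
      fun z => (f (sphereProj e z) : ℝ))
    (fun n => hfm.indicator (hs _))
    (fun n => Set.indicator_nonneg fun z _ => NNReal.coe_nonneg _) (M := nndist f 0)
    (fun n => Set.indicator_le' (fun z _ =>
      NNReal.coe_le_coe.2 (BoundedContinuousFunction.NNReal.upper_bound f _))
      fun z _ => NNReal.coe_nonneg _) hk (hlim.congr fun n => ?_)
  · refine h.congr fun q => ?_
    rw [exceedanceSum, exceedances, Finset.sum_filter]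
    congr 1
  · simp only [Function.comp_apply, tailIntegral]
    have hs0 : MeasurableSet {ω | u * b ((n : ℝ) / k n) < normDist p F (Z 0 ω)} := hZ 0 (hs _)
    congr 1
    rw [integral_eq_lintegral_of_nonneg_ae
      (Eventually.of_forall fun ω => Set.indicator_nonneg (fun z _ => NNReal.coe_nonneg _) _)
      ((hfm.indicator (hs _)).comp (hZ 0)).aestronglyMeasurable,
      ← lintegral_indicator hs0]
    congr 1
    refine lintegral_congr fun ω => ?_
    by_cases hω : u * b ((n : ℝ) / k n) < normDist p F (Z 0 ω)
    · rw [Set.indicator_of_mem (by exact hω), Set.indicator_of_mem (by exact hω),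
        ENNReal.ofReal_coe_nnreal]
    · rw [Set.indicator_of_notMem (by exact hω),
        Set.indicator_of_notMem (by exact hω), ENNReal.ofReal_zero]

/-- Sums over the exceedances of the `k+1`-st largest distance: this order statistic, divided by
`b(n/k)`, settles at the level `c` at which the tail function of the limit measure equals one. -/
lemma tendsto_exceedanceSum_distOrderStat (hp : ∀ x, p x = 0 → x = 0) (hC : IsClosedCone C)
    (hF : IsClosedCone F) (hZ : ∀ i, Measurable (Z i)) (hZC : ∀ i ω, Z i ω ∈ C)
    (hindep : iIndepFun Z P) (hident : ∀ i, IdentDistrib (Z i) (Z 0) P P)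
    (hRV : IsRegularlyVarying P p C F (Z 0) b ν) (hk : Tendsto k atTop atTop)
    (hnk : Tendsto (fun n : ℕ => (n : ℝ) / (k n : ℝ)) atTop atTop) (e : coneSphere p C F)
    (f : coneSphere p C F →ᵇ ℝ≥0) :
    Tendsto (fun q : ℕ × Ω => exceedanceSum e f q.1 (k q.1)
        (distOrderStat p F q.1 (k q.1) fun i => Z i q.2) fun i => Z i q.2) (inProbability P)
      (𝓝 (tailIntegral ν (coneDist p C F) (fun x => f (coneProj e x)) 1
        / tailIntegral ν (coneDist p C F) 1 1)) := by
  have hreg := regularScaling_of_isRegularlyVarying hp hC hF (hZ 0) (hZC 0) hRV e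
  have htl := tailLimit_of_isRegularlyVarying hp hC hF (hZ 0) (hZC 0) hRV e f
  have hsum := fun f' : coneSphere p C F →ᵇ ℝ≥0 => fun {u : ℝ} (hu : 0 < u) =>
    tendsto_exceedanceSum hp hC hF hZ hZC hindep hident hRV hk hnk e f' hu
  set H := tailIntegral ν (coneDist p C F) 1 with hH
  set g := tailIntegral ν (coneDist p C F) fun x => f (coneProj e x) with hg
  have hcount : ∀ {u : ℝ}, 0 < u → Tendsto (fun q : ℕ × Ω => exceedanceSum e 1 q.1 (k q.1)
      (u * b ((q.1 : ℝ) / k q.1)) fun i => Z i q.2) (inProbability P) (𝓝 (H u)) :=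
    fun hu => hsum 1 hu
  obtain ⟨c, hc, hHc⟩ : ∃ c, 0 < c ∧ H c = 1 := by
    obtain ⟨u, hu, hu1⟩ := hreg.exists_large 1
    obtain ⟨v, hv1, hv⟩ := ((hreg.tendsto_zero.eventually (gt_mem_nhds one_pos)).and
      (eventually_ge_atTop u)).exists
    obtain ⟨c, hc, h⟩ := intermediate_value_Icc' hv
      (hreg.continuousOn.mono fun x hx => hu.trans_le hx.1) ⟨hv1.le, hu1.le⟩
    exact ⟨c, hu.trans_le hc.1, h⟩
  -- Hence the limit at the random threshold equals `g c = g 1 / H 1`.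
  have hgH : ∀ {u : ℝ}, 0 < u → g u = g 1 / H 1 * H u := by
    intro u hu
    rw [div_mul_eq_mul_div, ← hreg.mul_eq_mul htl hu,
      mul_div_cancel_right₀ _ (hreg.pos one_pos).ne']
  have hgc : ContinuousAt g c := by
    have : ContinuousAt (fun u => g 1 / H 1 * H u) c :=
      (hreg.continuousOn.continuousAt (Ioi_mem_nhds hc)).const_mul _
    refine this.congr ?_
    filter_upwards [Ioi_mem_nhds hc] with u hu using (hgH hu).symm
  have hlim : g c = g 1 / H 1 := by rw [hgH hc, hHc, mul_one]
  have hkn : ∀ᶠ q in inProbability P, 0 < k q.1 ∧ k q.1 < q.1 := by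
    refine (tendsto_fst_inProbability P).eventually (p := fun n => 0 < k n ∧ k n < n) ?_
    filter_upwards [hk.eventually (eventually_gt_atTop 0),
      hnk.eventually (eventually_gt_atTop 1)] with n h1 h2
    rw [one_lt_div (Nat.cast_pos.2 h1)] at h2
    exact ⟨h1, Nat.cast_lt.1 h2⟩
  -- The order statistic lies between `u * b (n / k)` and `v * b (n / k)` for any `u < c < v`.
  have hlow : ∀ u, 0 < u → u < c → ∀ᶠ q in inProbability P, u * b ((q.1 : ℝ) / k q.1)
      < distOrderStat p F q.1 (k q.1) fun i => Z i q.2 := by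
    intro u hu huc
    have h1 : 1 < H u := hHc ▸ hreg.strictAntiOn (Set.mem_Ioi.2 hu) (Set.mem_Ioi.2 hc) huc
    filter_upwards [(hcount hu).eventually (lt_mem_nhds h1), hkn] with q hq hkq
    rw [exceedanceSum_one, inv_mul_eq_div, one_lt_div (Nat.cast_pos.2 hkq.1), Nat.cast_lt] at hq
    exact (lt_distOrderStat_iff hkq.2 _ _).2 hq
  have hup : ∀ u, c < u → ∀ᶠ q in inProbability P,
      (distOrderStat p F q.1 (k q.1) fun i => Z i q.2) ≤ u * b ((q.1 : ℝ) / k q.1) := by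
    intro u huc
    have h1 : H u < 1 :=
      hHc ▸ hreg.strictAntiOn (Set.mem_Ioi.2 hc) (Set.mem_Ioi.2 (hc.trans huc)) huc
    filter_upwards [(hcount (hc.trans huc)).eventually (gt_mem_nhds h1), hkn] with q hq hkq
    rw [exceedanceSum_one, inv_mul_eq_div, div_lt_one (Nat.cast_pos.2 hkq.1), Nat.cast_lt] at hq
    by_contra! hlt
    exact hq.not_gt ((lt_distOrderStat_iff hkq.2 _ _).1 hlt)
  rw [← hlim]
  refine tendsto_order.2 ⟨fun a ha => ?_, fun a ha => ?_⟩
  · obtain ⟨u, hua, huc⟩ : ∃ u, a < g u ∧ c < u :=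
      (((hgc.eventually (lt_mem_nhds ha)).filter_mono nhdsWithin_le_nhds).and
        (self_mem_nhdsWithin (s := Set.Ioi c))).exists
    filter_upwards [(hsum f (hc.trans huc)).eventually (lt_mem_nhds hua), hup u huc] with q h1 h2
    exact h1.trans_le (exceedanceSum_anti e f _ _ h2 _)
  · obtain ⟨u, ⟨hua, hu⟩, huc⟩ : ∃ u, (g u < a ∧ 0 < u) ∧ u < c :=
      ((((hgc.eventually (gt_mem_nhds ha)).and (Ioi_mem_nhds hc)).filter_mono
        nhdsWithin_le_nhds).and (self_mem_nhdsWithin (s := Set.Iio c))).exists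
    filter_upwards [(hsum f hu).eventually (gt_mem_nhds hua), hlow u hu huc] with q h1 h2
    exact (exceedanceSum_anti e f _ _ h2.le _).trans_lt h1

end Exceedances

/-! ### Measurability of random point measures -/

section PointMeasure

/-- The point measure `∑_{i ∈ J} ε_{y i}`, as a finite measure. -/
noncomputable def pointMeasure {E : Type*} [MeasurableSpace E] (J : Finset ℕ)
    (y : ℕ → E) : FiniteMeasure E :=
  ∑ i ∈ J, (diracProba (y i)).toFiniteMeasure

lemma toMeasure_pointMeasure {E : Type*} [MeasurableSpace E] (J : Finset ℕ) (y : ℕ → E) :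
    (pointMeasure J y : Measure E) = ∑ i ∈ J, Measure.dirac (y i) := by
  rw [pointMeasure, FiniteMeasure.toMeasure_sum]
  rfl

lemma isProbabilityMeasure_inv_card_smul {E : Type*} [MeasurableSpace E] {J : Finset ℕ}
    (hJ : J.Nonempty) (y : ℕ → E) :
    IsProbabilityMeasure ((J.card : ℝ≥0∞)⁻¹ • (pointMeasure J y : Measure E)) := by
  refine ⟨?_⟩
  rw [toMeasure_pointMeasure, Measure.smul_apply, Measure.finsetSum_apply]
  simp only [measure_univ, Finset.sum_const, nsmul_eq_mul, mul_one, smul_eq_mul]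
  exact ENNReal.inv_mul_cancel (by simpa using hJ.ne_empty) (ENNReal.natCast_ne_top _)

/-- The uniform distribution on the points `y i`, `i ∈ J`, and the value `S₀` for empty `J`. -/
noncomputable def normalizedPointMeasure {E : Type*} [MeasurableSpace E]
    (S₀ : ProbabilityMeasure E) (J : Finset ℕ) (y : ℕ → E) : ProbabilityMeasure E :=
  if hJ : J.Nonempty then
    ⟨(J.card : ℝ≥0∞)⁻¹ • (pointMeasure J y : Measure E), isProbabilityMeasure_inv_card_smul hJ y⟩
  else S₀

lemma toMeasure_normalizedPointMeasure {E : Type*} [MeasurableSpace E]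
    (S₀ : ProbabilityMeasure E) {J : Finset ℕ} (hJ : J.Nonempty) (y : ℕ → E) :
    (normalizedPointMeasure S₀ J y : Measure E)
      = (J.card : ℝ≥0∞)⁻¹ • (pointMeasure J y : Measure E) :=
  congrArg Subtype.val (dif_pos hJ)

variable {E : Type*} [TopologicalSpace E] [MeasurableSpace E] [OpensMeasurableSpace E]

lemma continuous_pointMeasure (J : Finset ℕ) :
    Continuous (pointMeasure J : (ℕ → E) → FiniteMeasure E) :=
  continuous_finsetSum _ fun i _ => ProbabilityMeasure.toFiniteMeasure_continuous.comp
    (continuous_diracProba.comp (continuous_apply i))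

/-- A function that is chosen, among continuous functions of countably many random points, by a
random finite set of indices is measurable. For random measures this gives measurability with
respect to the Borel `σ`-algebra of the weak topology without comparing it with the `σ`-algebra
generated by the evaluations. -/
lemma measurable_of_finset_of_continuous {Ω T : Type*} [MeasurableSpace Ω] [TopologicalSpace T]
    [MeasurableSpace T] [BorelSpace T] [BorelSpace E] [SecondCountableTopology E]
    {J : Ω → Finset ℕ} (hJ : ∀ i, MeasurableSet {ω | i ∈ J ω}) {Y : ℕ → Ω → E}
    (hY : ∀ i, Measurable (Y i)) {G : Finset ℕ → (ℕ → E) → T} (hG : ∀ J, Continuous (G J)) :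
    Measurable fun ω => G (J ω) fun i => Y i ω := by
  let _ : MeasurableSpace (Finset ℕ) := ⊤
  have hJm : Measurable J := by
    refine measurable_to_countable' fun J₀ => ?_
    have : J ⁻¹' {J₀} = ⋂ i, {ω | i ∈ J ω ↔ i ∈ J₀} := by
      ext ω
      simp [Finset.ext_iff]
    rw [this]
    exact MeasurableSet.iInter fun i => (hJ i).iff (MeasurableSet.const _)
  have hpair : Measurable fun q : Finset ℕ × (ℕ → E) => G q.1 q.2 :=
    measurable_from_prod_countable_right fun J => (hG J).measurable
  exact hpair.comp (hJm.prodMk (measurable_pi_lambda _ hY))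

lemma continuous_normalizedPointMeasure (S₀ : ProbabilityMeasure E) (J : Finset ℕ) :
    Continuous (normalizedPointMeasure S₀ J) := by
  by_cases hJ : J.Nonempty
  · rw [(ProbabilityMeasure.toFiniteMeasure_isEmbedding E).continuous_iff]
    have : (ProbabilityMeasure.toFiniteMeasure ∘ normalizedPointMeasure S₀ J)
        = fun y => (J.card : ℝ≥0)⁻¹ • pointMeasure J y := by
      ext1 y
      apply FiniteMeasure.toMeasure_injective
      rw [FiniteMeasure.toMeasure_smul, ENNReal.smul_def,
        ENNReal.coe_inv (by simpa using hJ.ne_empty), ENNReal.coe_natCast]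
      exact toMeasure_normalizedPointMeasure S₀ hJ y
    rw [this]
    exact (continuous_const_smul _).comp (continuous_pointMeasure J)
  · have : normalizedPointMeasure S₀ J = fun _ => S₀ := funext fun y => dif_neg hJ
    rw [this]
    exact continuous_const

lemma lintegral_pointMeasure (J : Finset ℕ) (y : ℕ → E) (f : E →ᵇ ℝ≥0) :
    ∫⁻ x, f x ∂(pointMeasure J y : Measure E) = ENNReal.ofReal (∑ i ∈ J, (f (y i) : ℝ)) := by
  have hf : Measurable fun x => (f x : ℝ≥0∞) := f.continuous.measurable.coe_nnreal_ennreal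
  rw [toMeasure_pointMeasure, lintegral_finsetSum_measure, ENNReal.ofReal_sum_of_nonneg
    fun _ _ => NNReal.coe_nonneg _]
  refine Finset.sum_congr rfl fun i _ => ?_
  rw [lintegral_dirac' _ hf, ENNReal.ofReal_coe_nnreal]

end PointMeasure

/-! ### The estimators -/

section Estimators

variable {d : ℕ} {p : Seminorm ℝ (Fin d → ℝ)} {C F : Set (Fin d → ℝ)}

lemma angularMeasure_distOrderStat_eq (hC : IsClosedCone C) (hF : IsClosedCone F)
    (e : coneSphere p C F) (n k : ℕ) {z : ℕ → Fin d → ℝ} (hz : ∀ i, z i ∈ C) :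
    angularMeasure p C F n (distOrderStat p F n k z) z
      = pointMeasure (exceedances p F n (distOrderStat p F n k z) z)
          fun i => sphereProj e (z i) := by
  rw [toMeasure_pointMeasure, angularMeasure_eq hC hF e n (distOrderStat_nonneg n k z) hz]

lemma spectralEstimator_eq (hC : IsClosedCone C) (hF : IsClosedCone F) (e : coneSphere p C F)
    (S₀ : ProbabilityMeasure (coneSphere p C F)) (n k : ℕ) {z : ℕ → Fin d → ℝ}
    (hz : ∀ i, z i ∈ C) :
    spectralEstimator p C F S₀ n k z = normalizedPointMeasure S₀
      (exceedances p F n (distOrderStat p F n k z) z) fun i => sphereProj e (z i) := by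
  have hq : angularQuotient p C F n (distOrderStat p F n k z) z
      = ((exceedances p F n (distOrderStat p F n k z) z).card : ℝ≥0∞)⁻¹ •
        (pointMeasure (exceedances p F n (distOrderStat p F n k z) z) fun i =>
          sphereProj e (z i) : Measure (coneSphere p C F)) := by
    rw [angularQuotient, angularMeasure_distOrderStat_eq hC hF e n k hz]
  by_cases hJ : (exceedances p F n (distOrderStat p F n k z) z).Nonempty
  · have hprob := isProbabilityMeasure_inv_card_smul hJ fun i => sphereProj e (z i)
    rw [← hq] at hprob
    exact (dif_pos hprob).trans ((Subtype.ext hq).trans (dif_pos hJ).symm)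
  · rw [show normalizedPointMeasure S₀ (exceedances p F n (distOrderStat p F n k z) z)
      (fun i => sphereProj e (z i)) = S₀ from dif_neg hJ]
    refine dif_neg fun hprob => ?_
    have h1 := hprob.measure_univ
    rw [hq, Finset.not_nonempty_iff_eq_empty.1 hJ, toMeasure_pointMeasure] at h1
    simp at h1

lemma spectralEstimatorK_eq (hC : IsClosedCone C) (hF : IsClosedCone F) (e : coneSphere p C F)
    (n k : ℕ) {z : ℕ → Fin d → ℝ} (hz : ∀ i, z i ∈ C) :
    spectralEstimatorK p C F n k z = (k : ℝ≥0)⁻¹ • pointMeasure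
      (exceedances p F n (distOrderStat p F n k z) z) fun i => sphereProj e (z i) := by
  exact congrArg (fun M : FiniteMeasure (coneSphere p C F) => (k : ℝ≥0)⁻¹ • M)
    (Subtype.ext (angularMeasure_distOrderStat_eq hC hF e n k hz))

variable {Ω : Type*} [MeasurableSpace Ω] {Z : ℕ → Ω → Fin d → ℝ}

lemma measurableSet_mem_exceedances (hF : IsClosedCone F) (hZ : ∀ i, Measurable (Z i))
    (n k i : ℕ) : MeasurableSet {ω | i ∈ exceedances p F n
      (distOrderStat p F n k fun i => Z i ω) fun i => Z i ω} := by
  simp only [exceedances, Finset.mem_filter]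
  exact (MeasurableSet.const _).inter (measurableSet_lt (measurable_distOrderStat hF hZ n k)
    ((continuous_normDist p hF).measurable.comp (hZ i)))

lemma measurable_spectralEstimator (hC : IsClosedCone C) (hF : IsClosedCone F)
    (e : coneSphere p C F) (hZ : ∀ i, Measurable (Z i)) (hZC : ∀ i ω, Z i ω ∈ C)
    (S₀ : ProbabilityMeasure (coneSphere p C F)) (n k : ℕ) :
    @Measurable _ _ _ (borel _)
      fun ω => spectralEstimator p C F S₀ n k fun i => Z i ω := by
  let _ : MeasurableSpace (ProbabilityMeasure (coneSphere p C F)) := borel _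
  have : BorelSpace (ProbabilityMeasure (coneSphere p C F)) := ⟨rfl⟩
  simp only [fun ω => spectralEstimator_eq hC hF e S₀ n k fun i => hZC i ω]
  exact measurable_of_finset_of_continuous (measurableSet_mem_exceedances hF hZ n k)
    (fun i => (measurable_sphereProj hC hF e).comp (hZ i)) (continuous_normalizedPointMeasure S₀)

lemma measurable_spectralEstimatorK (hC : IsClosedCone C) (hF : IsClosedCone F)
    (e : coneSphere p C F) (hZ : ∀ i, Measurable (Z i)) (hZC : ∀ i ω, Z i ω ∈ C) (n k : ℕ) :
    @Measurable _ _ _ (borel _)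
      fun ω => spectralEstimatorK p C F n k fun i => Z i ω := by
  let _ : MeasurableSpace (FiniteMeasure (coneSphere p C F)) := borel _
  have : BorelSpace (FiniteMeasure (coneSphere p C F)) := ⟨rfl⟩
  simp only [fun ω => spectralEstimatorK_eq hC hF e n k fun i => hZC i ω]
  exact measurable_of_finset_of_continuous
    (G := fun J y => (k : ℝ≥0)⁻¹ • pointMeasure J y) (measurableSet_mem_exceedances hF hZ n k)
    (fun i => (measurable_sphereProj hC hF e).comp (hZ i))
    fun J => (continuous_const_smul _).comp (continuous_pointMeasure J)

variable {P : Measure Ω} [IsProbabilityMeasure P] {b : ℝ → ℝ} {ν : Measure (openCone C F)}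

/-- The sphere is nonempty, since a nonzero measure lives on a nonempty space. -/
lemma nonempty_coneSphere (hp : ∀ x, p x = 0 → x = 0) (hC : IsClosedCone C)
    (hF : IsClosedCone F) (hν : ν ≠ 0) : Nonempty (coneSphere p C F) := by
  by_contra h
  refine hν (@Measure.eq_zero_of_isEmpty _ ⟨fun x => h ⟨?_⟩⟩ _ ν)
  exact ⟨_, inv_normDist_smul_mem hC hF x.2.1 (normDist_pos hp hF x.2.2)⟩

lemma setOf_le_coneDist_ae_eq {u : ℝ} (hu : u ∈ regularLevels p C F ν) :
    ({x | u ≤ coneDist p C F x} : Set (openCone C F)) =ᵐ[ν] {x | u < coneDist p C F x} := by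
  refine ae_eq_set.2 ⟨measure_mono_null ?_ hu.2, ?_⟩
  · rintro x ⟨hx : u ≤ _, hx' : ¬ u < _⟩
    exact (not_lt.1 hx').antisymm hx
  · refine measure_mono_null ?_ measure_empty
    rintro x ⟨hx : u < _, hx' : ¬ u ≤ _⟩
    exact hx' hx.le

/-- Integrals against the spectral measure are normalized tail integrals. In the definition the
tail set is `{d(x, F) ≥ 1}`, which differs from `{d(x, F) > 1}` by a null set. -/
lemma lintegral_spectralMeasure (hC : IsClosedCone C) (hF : IsClosedCone F)
    (hν : InMStar p C F ν) (e : coneSphere p C F)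
    (h1 : 1 ∈ regularLevels p C F ν) (hpos : 0 < tailIntegral ν (coneDist p C F) 1 1)
    (f : coneSphere p C F →ᵇ ℝ≥0) :
    ∫⁻ y, f y ∂(spectralMeasure p C F ν) = ENNReal.ofReal
      (tailIntegral ν (coneDist p C F) (fun x => f (coneProj e x)) 1
        / tailIntegral ν (coneDist p C F) 1 1) := by
  have hfin := hν.measure_lt_top one_pos
  have hproj : Measurable fun x : openCone C F => sphereProj e (x : Fin d → ℝ) :=
    (measurable_sphereProj hC hF e).comp measurable_subtype_coe
  have hf : Measurable fun y => (f y : ℝ≥0∞) := f.continuous.measurable.coe_nnreal_ennreal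
  have hset := setOf_le_coneDist_ae_eq h1
  rw [spectralMeasure_eq hC hF e, lintegral_smul_measure, lintegral_map hf hproj]
  change (ν {x | 1 ≤ coneDist p C F x})⁻¹ • ∫⁻ x in {x | 1 ≤ coneDist p C F x},
    f (coneProj e x) ∂ν = _
  rw [measure_congr hset, setLIntegral_congr hset, ENNReal.ofReal_div_of_pos hpos,
    tailIntegral_one, ENNReal.ofReal_toReal hfin.ne, tailIntegral, ENNReal.ofReal_toReal
    (setLIntegral_lt_top_of_le hfin
      fun x => BoundedContinuousFunction.NNReal.upper_bound f _).ne, smul_eq_mul, mul_comm,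
    div_eq_mul_inv]

end Estimators

theorem proposition6p2 {d : ℕ} (p : Seminorm ℝ (Fin d → ℝ)) (hp : ∀ x, p x = 0 → x = 0)
    (C F : Set (Fin d → ℝ)) (hC : IsClosedCone C) (hF : IsClosedCone F) (hFC : F ⊆ C)
    {Ω : Type*} [MeasurableSpace Ω] (P : Measure Ω) [IsProbabilityMeasure P]
    (Z : ℕ → Ω → Fin d → ℝ) (hZ : ∀ i, Measurable (Z i)) (hZC : ∀ i ω, Z i ω ∈ C)
    (hindep : iIndepFun Z P) (hident : ∀ i, IdentDistrib (Z i) (Z 0) P P)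
    (b : ℝ → ℝ) (ν : Measure (openCone C F)) (hRV : IsRegularlyVarying P p C F (Z 0) b ν)
    (k : ℕ → ℕ) (hk : Tendsto k atTop atTop)
    (hnk : Tendsto (fun n : ℕ => (n : ℝ) / (k n : ℝ)) atTop atTop) :
    -- the spectral measure is a probability measure on the unit sphere
    ∃ hS : IsProbabilityMeasure (spectralMeasure p C F ν),
      -- with probability tending to one, the denominator of the estimator is nonzero
      Tendsto (fun n : ℕ => P {ω | (exceedances p F n
        (distOrderStat p F n (k n) (fun i => Z i ω)) (fun i => Z i ω)).Nonempty}) atTop (𝓝 1) ∧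
      -- weak convergence of the estimator as a random probability measure
      (∀ S₀ : ProbabilityMeasure (coneSphere p C F),
        WeaklyConvergesTo P
          (fun (n : ℕ) (ω : Ω) => spectralEstimator p C F S₀ n (k n) (fun i => Z i ω))
          (⟨spectralMeasure p C F ν, hS⟩ : ProbabilityMeasure (coneSphere p C F))) ∧
      -- the same for the version with the factor `1 / k`, as a random finite measure
      WeaklyConvergesTo P
        (fun (n : ℕ) (ω : Ω) => spectralEstimatorK p C F n (k n) (fun i => Z i ω))
        (ProbabilityMeasure.toFiniteMeasure ⟨spectralMeasure p C F ν, hS⟩) := by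
  obtain ⟨e⟩ := nonempty_coneSphere hp hC hF hRV.ne_zero
  have hpos := (regularScaling_of_isRegularlyVarying hp hC hF (hZ 0) (hZC 0) hRV e).pos one_pos
  have hlint := lintegral_spectralMeasure hC hF hRV.inMStar e
    (mem_regularLevels hp hC hF (hZ 0) (hZC 0) hRV e one_pos) hpos
  have hlim := tendsto_exceedanceSum_distOrderStat hp hC hF hZ hZC hindep hident hRV hk hnk e
  have hcount : Tendsto (fun q : ℕ × Ω => exceedanceSum e 1 q.1 (k q.1)
      (distOrderStat p F q.1 (k q.1) fun i => Z i q.2) fun i => Z i q.2) (inProbability P)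
      (𝓝 1) := by
    have := hlim 1
    rwa [show (fun x => (1 : coneSphere p C F →ᵇ ℝ≥0) (coneProj e x)) = 1 from rfl,
      div_self hpos.ne'] at this
  have hS : IsProbabilityMeasure (spectralMeasure p C F ν) := by
    refine ⟨?_⟩
    have := hlint 1
    rw [show (fun x => (1 : coneSphere p C F →ᵇ ℝ≥0) (coneProj e x)) = 1 from rfl,
      div_self hpos.ne'] at this
    simpa using this
  have hne : ∀ᶠ q in inProbability P, (exceedances p F q.1
      (distOrderStat p F q.1 (k q.1) fun i => Z i q.2) fun i => Z i q.2).Nonempty := by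
    filter_upwards [hcount.eventually (lt_mem_nhds one_pos)] with q hq
    rw [exceedanceSum_one] at hq
    by_contra h
    rw [Finset.not_nonempty_iff_eq_empty.1 h] at hq
    simp at hq
  have hk0 : ∀ᶠ q in inProbability P, 0 < k q.1 :=
    (tendsto_fst_inProbability P).eventually (hk.eventually (eventually_gt_atTop 0))
  refine ⟨hS, tendsto_measure_of_eventually hne, fun S₀ => ?_, ?_⟩
  · refine weaklyConvergesTo_of_tendsto
      (fun n => measurable_spectralEstimator hC hF e hZ hZC S₀ n (k n)) ?_
    refine ProbabilityMeasure.tendsto_iff_forall_lintegral_tendsto.2 fun f => ?_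
    have h := ENNReal.tendsto_ofReal ((hlim f).div hcount one_ne_zero)
    rw [div_one, ← hlint f] at h
    refine h.congr' ?_
    filter_upwards [hne, hk0] with q hq hkq
    have hcard : (0 : ℝ) < (exceedances p F q.1
      (distOrderStat p F q.1 (k q.1) fun i => Z i q.2) fun i => Z i q.2).card :=
      Nat.cast_pos.2 hq.card_pos
    have hkr : (0 : ℝ) < k q.1 := Nat.cast_pos.2 hkq
    rw [spectralEstimator_eq hC hF e S₀ q.1 (k q.1) fun i => hZC i q.2,
      toMeasure_normalizedPointMeasure S₀ hq, lintegral_smul_measure, lintegral_pointMeasure,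
      Pi.div_apply, exceedanceSum_one, exceedanceSum,
      mul_div_mul_left _ _ (inv_ne_zero hkr.ne'), ENNReal.ofReal_div_of_pos hcard,
      ENNReal.ofReal_natCast, smul_eq_mul, mul_comm, div_eq_mul_inv]
  · refine weaklyConvergesTo_of_tendsto
      (fun n => measurable_spectralEstimatorK hC hF e hZ hZC n (k n)) ?_
    refine FiniteMeasure.tendsto_iff_forall_lintegral_tendsto.2 fun f => ?_
    have h := ENNReal.tendsto_ofReal (hlim f)
    rw [← hlint f] at h
    refine h.congr' ?_
    filter_upwards [hk0] with q hkq
    have hkr : (0 : ℝ) < k q.1 := Nat.cast_pos.2 hkq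
    rw [spectralEstimatorK_eq hC hF e q.1 (k q.1) fun i => hZC i q.2, FiniteMeasure.toMeasure_smul,
      ENNReal.smul_def, lintegral_smul_measure, lintegral_pointMeasure, exceedanceSum,
      ENNReal.ofReal_mul (inv_nonneg.2 hkr.le), smul_eq_mul, ENNReal.ofReal_inv_of_pos hkr,
      ENNReal.coe_inv (by exact_mod_cast hkq.ne'), ENNReal.coe_natCast, ENNReal.ofReal_natCast]
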